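/- Let $f:\mathbb Z\to[0,\infty)$. The wedge comb $\mathrm{Comb}(\mathbb Z,f)$ is the graph with vertex set $\{(x,y)\in\mathbb Z^2 : -f(x)\le y\le f(x)\}$ in which $(x,m)$ and $(x,n)$ are joined by an edge whenever $|m-n|=1$, and $(x,0)$ and $(y,0)$ are joined by an edge whenever $|x-y|=1$. A simple random walk on a graph is the Markov chain that at each step jumps from its current vertex to a neighbour chosen uniformly at random. Suppose that $f(-n)+f(n)=O(n\log n)$ as $n\to\infty$. Then any two independent simple random walks $(X_n)_{n\ge0}$ and $(X'_n)_{n\ge0}$ on $\mathrm{Comb}(\mathbb Z,f)$ that start from the same vertex collide infinitely many times almost surely, i.e. $|\{n : X_n=X'_n\}|=\infty$ with probability one. -/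

import Mathlib

open MeasureTheory ProbabilityTheory Filter Asymptotics

/-- The vertex set of the wedge comb with profile `f`: the lattice points `(x, y)` with
`-f x ≤ y ≤ f x`. -/
def combVertices (f : ℤ → ℝ) : Set (ℤ × ℤ) :=
  {p | -f p.1 ≤ (p.2 : ℝ) ∧ (p.2 : ℝ) ≤ f p.1}

/-- The wedge comb `Comb(ℤ, f)`: two vertices are joined if they are consecutive points of the same
vertical tooth, or consecutive points of the horizontal axis. -/
def wedgeComb (f : ℤ → ℝ) : SimpleGraph (combVertices f) where
  Adj p q :=
    (p.1.1 = q.1.1 ∧ |p.1.2 - q.1.2| = 1) ∨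
      (p.1.2 = 0 ∧ q.1.2 = 0 ∧ |p.1.1 - q.1.1| = 1)
  symm := ⟨by
    rintro p q (⟨h, h'⟩ | ⟨h, h', h''⟩)
    · exact Or.inl ⟨h.symm, by rw [abs_sub_comm]; exact h'⟩
    · exact Or.inr ⟨h', h, by rw [abs_sub_comm]; exact h''⟩⟩
  loopless := ⟨by
    rintro p (⟨_, h⟩ | ⟨_, _, h⟩) <;> simp at h⟩

theorem wedgeComb_neighborSet_finite (f : ℤ → ℝ) (p : combVertices f) :
    ((wedgeComb f).neighborSet p).Finite := by
  have hfin : ((Set.Icc (p.1.1 - 1) (p.1.1 + 1)) ×ˢ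
      (Set.Icc (p.1.2 - 1) (p.1.2 + 1)) : Set (ℤ × ℤ)).Finite :=
    (Set.finite_Icc _ _).prod (Set.finite_Icc _ _)
  refine (hfin.preimage (Subtype.val_injective.injOn)).subset ?_
  intro q hq
  have hq' : (p.1.1 = q.1.1 ∧ |p.1.2 - q.1.2| = 1) ∨
      (p.1.2 = 0 ∧ q.1.2 = 0 ∧ |p.1.1 - q.1.1| = 1) := hq
  simp only [Set.mem_preimage, Set.mem_prod, Set.mem_Icc]
  rcases hq' with ⟨h, h'⟩ | ⟨h, h', h''⟩
  · have := abs_le.1 h'.le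
    omega
  · have := abs_le.1 h''.le
    omega

noncomputable instance wedgeCombLocallyFinite (f : ℤ → ℝ) : (wedgeComb f).LocallyFinite :=
  fun p => (wedgeComb_neighborSet_finite f p).fintype

open Classical in
/-- The one-step transition probabilities of the simple random walk on a locally finite graph:
the walk jumps to each neighbour of its present position with equal probability. -/
noncomputable def srwStep {V : Type*} (G : SimpleGraph V) [G.LocallyFinite] (v w : V) : ℝ :=
  if G.Adj v w then 1 / (G.degree v : ℝ) else 0

/-- `X` is, under the probability measure `μ`, a simple random walk on the (countable, locally
finite) graph `G` started at the vertex `o`: the Markov chain with `X 0 = o` almost surely and with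
transition probabilities `srwStep G`. The Markov property
`μ (X (n+1) = w | X 0 = γ 0, …, X n = γ n) = srwStep G (γ n) w` is written multiplied out, so
that conditioning events of probability zero need no separate treatment. -/
structure IsSimpleRandomWalk {V : Type*} [MeasurableSpace V] (G : SimpleGraph V) [G.LocallyFinite]
    (o : V) {Ω : Type*} [MeasurableSpace Ω] (μ : Measure Ω) (X : ℕ → Ω → V) : Prop where
  measurable : ∀ n, Measurable (X n)
  start : ∀ᵐ ω ∂μ, X 0 ω = o
  markov : ∀ (n : ℕ) (γ : ℕ → V) (w : V),
    μ.real {ω | (∀ i ≤ n, X i ω = γ i) ∧ X (n + 1) ω = w} =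
      μ.real {ω | ∀ i ≤ n, X i ω = γ i} * srwStep G (γ n) w

/-! ### Green functions and meeting counts of killed walks on a general graph -/

section KilledWalk

variable {V : Type*} (G : SimpleGraph V) [G.LocallyFinite]

/-! The heart of the proof is a lower bound, uniform over starting pairs of equal parity, for the
probability that the two walkers ever meet (`exists_meeting_probability`). It comes from a weighted
second moment argument over dyadic scales.

Kill the walks on leaving the box `|x| < 2 ^ k`. Degrees lie between 1 and 4, so reversibility makes
the probability of meeting at time `n` comparable to the `2n`-step killed kernel. The expected
number of meetings is therefore comparable to the Green function, odd times contributing nothing for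
equal parities. Teeth are dead ends, so that Green function is explicit
(`hasSum_killedHeat_combBox`): an axis term of order `2 ^ k` away from the ends, plus the common
part of two paths in the same tooth.

Hence meetings in box `k` have mean at least of order `2 ^ k`. After a meeting at height `h`, the
expected number of further ones is at most of order `2 ^ k + |h|`, and the growth hypothesis gives
`|h| ≤ A * k * 2 ^ k`. At a single scale this bounds the ratio of the second moment to the squared
mean only by order `k`. So box `k` gets weight `1 / (k * 2 ^ k)` and the scales `N ≤ k ≤ 2N` are
summed. With `S = ∑ 1 / k ≥ 1 / 2`, the mean is of order at least `S`. The second moment is at most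
of order `S ^ 2 + A * S`, since the height terms decay geometrically in `|j - k|`. The ratio no
longer depends on the starting points.

Walkers started together always have equal parity, so at every time, given the past, a meeting from
then on has conditional probability at least a fixed `c > 0`. This forces infinitely many meetings
(`IsWalkPair.ae_infinite_meetings`). -/

theorem srwStep_nonneg (v w : V) : 0 ≤ srwStep G v w := by
  unfold srwStep
  split_ifs <;> positivity

theorem degree_mul_srwStep (v w : V) :
    (G.degree v : ℝ) * srwStep G v w = G.degree w * srwStep G w v := by
  unfold srwStep
  by_cases h : G.Adj v w
  · have hv : (G.degree v : ℝ) ≠ 0 := by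
      exact_mod_cast ((G.degree_pos_iff_exists_adj v).2 ⟨w, h⟩).ne'
    have hw : (G.degree w : ℝ) ≠ 0 := by
      exact_mod_cast ((G.degree_pos_iff_exists_adj w).2 ⟨v, h.symm⟩).ne'
    simp [h, h.symm, hv, hw]
  · have h' : ¬ G.Adj w v := fun h' => h h'.symm
    simp [h, h']

/-- A sum of `srwStep G v w * h w` over a set `B` is the neighbourhood average of `h`, if `h`
vanishes at the neighbours outside `B`. -/
theorem sum_srwStep_mul (B : Finset V) (v : V) (h : V → ℝ)
    (hB : ∀ w, G.Adj v w → w ∉ B → h w = 0) :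
    ∑ w ∈ B, srwStep G v w * h w = (∑ w ∈ G.neighborFinset v, h w) / G.degree v := by
  classical
  have h1 : ∑ w ∈ B, srwStep G v w * h w = ∑ w ∈ B ∩ G.neighborFinset v, h w / G.degree v := by
    rw [← Finset.filter_mem_eq_inter, Finset.sum_filter]
    refine Finset.sum_congr rfl fun w _ => ?_
    unfold srwStep
    by_cases hw : G.Adj v w
    · simp [hw, div_eq_inv_mul]
    · simp [hw]
  rw [h1, Finset.sum_div]
  refine Finset.sum_subset Finset.inter_subset_right fun w hw hw' => ?_
  rw [SimpleGraph.mem_neighborFinset] at hw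
  have : w ∉ B := fun hwB => hw' (Finset.mem_inter.2 ⟨hwB, by simpa using hw⟩)
  rw [hB w hw this, zero_div]

open Classical in
/-- The heat kernel of the simple random walk on `G` killed when it leaves the finite set `B`. -/
noncomputable def killedHeat (B : Finset V) : ℕ → V → V → ℝ
  | 0, x, y => if x = y then 1 else 0
  | n + 1, x, y => ∑ w ∈ B, srwStep G x w * killedHeat B n w y

variable {G} {B : Finset V}

theorem killedHeat_nonneg (n : ℕ) (x y : V) : 0 ≤ killedHeat G B n x y := by
  induction n generalizing x with
  | zero => unfold killedHeat; split_ifs <;> norm_num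
  | succ n ih =>
    exact Finset.sum_nonneg fun w _ => mul_nonneg (srwStep_nonneg G x w) (ih w)

theorem killedHeat_add (m n : ℕ) {x : V} (hx : x ∈ B) (y : V) :
    killedHeat G B (m + n) x y = ∑ v ∈ B, killedHeat G B m x v * killedHeat G B n v y := by
  induction m generalizing x with
  | zero => classical simp [killedHeat, hx]
  | succ m ih =>
    rw [show m + 1 + n = (m + n) + 1 by ring]
    simp only [killedHeat, Finset.sum_mul]
    rw [Finset.sum_comm]
    refine Finset.sum_congr rfl fun w hw => ?_
    rw [ih hw, Finset.mul_sum]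
    simp only [mul_assoc]

theorem killedHeat_one {y : V} (hy : y ∈ B) (x : V) : killedHeat G B 1 x y = srwStep G x y := by
  classical simp [killedHeat, hy]

theorem degree_mul_killedHeat (n : ℕ) {x y : V} (hx : x ∈ B) (hy : y ∈ B) :
    (G.degree x : ℝ) * killedHeat G B n x y = G.degree y * killedHeat G B n y x := by
  induction n generalizing x with
  | zero =>
    by_cases h : x = y
    · rw [h]
    · simp [killedHeat, h, Ne.symm h]
  | succ n ih =>
    rw [killedHeat_add n 1 hy x, killedHeat, Finset.mul_sum, Finset.mul_sum]
    refine Finset.sum_congr rfl fun w hw => ?_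
    rw [killedHeat_one hx, ← mul_assoc, degree_mul_srwStep, mul_right_comm, ih hw]
    ring

/-- The representation of a solution `h` of the Poisson equation with source at `y`. -/
theorem sum_killedHeat_add {y : V} {h : V → ℝ}
    (hh : ∀ x ∈ B, h x = killedHeat G B 0 x y + ∑ w ∈ B, srwStep G x w * h w) (n : ℕ)
    {x : V} (hx : x ∈ B) :
    ∑ i ∈ Finset.range n, killedHeat G B i x y + ∑ v ∈ B, killedHeat G B n x v * h v = h x := by
  induction n generalizing x with
  | zero => classical simp [killedHeat, hx]
  | succ n ih =>
    rw [Finset.sum_range_succ', hh x hx, add_right_comm, add_comm]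
    congr 1
    simp only [killedHeat, Finset.sum_mul]
    rw [Finset.sum_comm (s := Finset.range n)]
    conv_lhs => enter [2]; rw [Finset.sum_comm]
    rw [← Finset.sum_add_distrib]
    refine Finset.sum_congr rfl fun w hw => ?_
    rw [← ih hw, mul_add, Finset.mul_sum, Finset.mul_sum]
    simp only [mul_assoc]

theorem sum_killedHeat_le {y : V} {h : V → ℝ} (h0 : ∀ x ∈ B, 0 ≤ h x)
    (hh : ∀ x ∈ B, h x = killedHeat G B 0 x y + ∑ w ∈ B, srwStep G x w * h w) (n : ℕ)
    {x : V} (hx : x ∈ B) :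
    ∑ i ∈ Finset.range n, killedHeat G B i x y ≤ h x := by
  rw [← sum_killedHeat_add hh n hx]
  have : 0 ≤ ∑ v ∈ B, killedHeat G B n x v * h v :=
    Finset.sum_nonneg fun v hv => mul_nonneg (killedHeat_nonneg n x v) (h0 v hv)
  linarith

/-- If every point of `B` admits a nonnegative solution of the Poisson equation, then such a
solution is the Green function of the killed walk. -/
theorem hasSum_killedHeat {h : V → V → ℝ} (h0 : ∀ y ∈ B, ∀ x ∈ B, 0 ≤ h y x)
    (hh : ∀ y ∈ B, ∀ x ∈ B,
      h y x = killedHeat G B 0 x y + ∑ w ∈ B, srwStep G x w * h y w)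
    {x y : V} (hx : x ∈ B) (hy : y ∈ B) :
    HasSum (fun n => killedHeat G B n x y) (h y x) := by
  have hsum : ∀ v ∈ B, Summable fun n => killedHeat G B n x v := fun v hv =>
    summable_of_sum_range_le (fun n => killedHeat_nonneg n x v)
      (fun n => sum_killedHeat_le (h0 v hv) (hh v hv) n hx)
  -- Solutions for every source make each kernel summable, so the surviving mass tends to 0 and the
  -- remainder term vanishes.
  have hlim : Tendsto (fun n => ∑ v ∈ B, killedHeat G B n x v * h y v) atTop (nhds 0) := by
    have : Tendsto (fun n => ∑ v ∈ B, killedHeat G B n x v * h y v) atTop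
        (nhds (∑ v ∈ B, 0 * h y v)) :=
      tendsto_finsetSum _ fun v hv => ((hsum v hv).tendsto_atTop_zero).mul_const _
    simpa using this
  rw [(hsum y hy).hasSum_iff_tendsto_nat]
  have h2 : ∀ n, ∑ i ∈ Finset.range n, killedHeat G B i x y =
      h y x - ∑ v ∈ B, killedHeat G B n x v * h y v := fun n => by
    rw [← sum_killedHeat_add (hh y hy) n hx]; ring
  simp only [h2]
  simpa using tendsto_const_nhds.sub hlim

variable (G B) in
/-- The probability that two independent walks from `x` and `y`, killed on leaving `B`, are at the
same vertex at time `n`. -/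
noncomputable def killedMeet (n : ℕ) (x y : V) : ℝ :=
  ∑ v ∈ B, killedHeat G B n x v * killedHeat G B n y v

theorem killedMeet_nonneg (n : ℕ) (x y : V) : 0 ≤ killedMeet G B n x y :=
  Finset.sum_nonneg fun v _ => mul_nonneg (killedHeat_nonneg n x v) (killedHeat_nonneg n y v)

/-- Reversing the second walk turns two paths that end together into a single path of length `2 * n`
from `x` to `y`, weighted by the degree of its midpoint. Bounded degrees then give both comparisons
with the kernel at time `2 * n`. -/
theorem degree_mul_killedMeet (n : ℕ) {x y : V} (hy : y ∈ B) :
    G.degree y * killedMeet G B n x y =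
      ∑ v ∈ B, G.degree v * (killedHeat G B n x v * killedHeat G B n v y) := by
  rw [killedMeet, Finset.mul_sum]
  refine Finset.sum_congr rfl fun v hv => ?_
  rw [mul_left_comm, degree_mul_killedHeat n hy hv]
  ring

theorem killedMeet_le {D : ℕ} (hD : ∀ v : V, 0 < G.degree v ∧ G.degree v ≤ D) (n : ℕ) {x y : V}
    (hx : x ∈ B) (hy : y ∈ B) : killedMeet G B n x y ≤ D * killedHeat G B (2 * n) x y := by
  have h1 : (1 : ℝ) ≤ G.degree y := by exact_mod_cast (hD y).1
  calc killedMeet G B n x y ≤ G.degree y * killedMeet G B n x y :=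
        le_mul_of_one_le_left (killedMeet_nonneg n x y) h1
    _ ≤ _ := by
        rw [degree_mul_killedMeet n hy, two_mul, killedHeat_add n n hx, Finset.mul_sum]
        refine Finset.sum_le_sum fun v _ => mul_le_mul_of_nonneg_right ?_
          (mul_nonneg (killedHeat_nonneg n x v) (killedHeat_nonneg n v y))
        exact_mod_cast (hD v).2

theorem le_killedMeet {D : ℕ} (hD : ∀ v : V, 0 < G.degree v ∧ G.degree v ≤ D) (n : ℕ) {x y : V}
    (hx : x ∈ B) (hy : y ∈ B) : killedHeat G B (2 * n) x y ≤ D * killedMeet G B n x y := by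
  have h1 : (G.degree y : ℝ) ≤ D := by exact_mod_cast (hD y).2
  calc killedHeat G B (2 * n) x y ≤ G.degree y * killedMeet G B n x y := by
        rw [degree_mul_killedMeet n hy, two_mul, killedHeat_add n n hx]
        refine Finset.sum_le_sum fun v _ => le_mul_of_one_le_left
          (mul_nonneg (killedHeat_nonneg n x v) (killedHeat_nonneg n v y)) ?_
        exact_mod_cast (hD v).1
    _ ≤ _ := mul_le_mul_of_nonneg_right h1 (killedMeet_nonneg n x y)

theorem killedHeat_eq_zero_of_parity {c : V → ZMod 2} (hc : ∀ v w, G.Adj v w → c w = c v + 1)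
    (n : ℕ) (x y : V) (h : c y ≠ c x + n) : killedHeat G B n x y = 0 := by
  induction n generalizing x with
  | zero =>
    have : x ≠ y := by rintro rfl; simp at h
    simp [killedHeat, this]
  | succ n ih =>
    rw [killedHeat]
    refine Finset.sum_eq_zero fun w _ => ?_
    by_cases hw : G.Adj x w
    · rw [ih w, mul_zero]
      rw [hc x w hw]
      intro h'
      apply h
      rw [h']
      push_cast
      ring
    · simp [srwStep, hw]

theorem sum_killedMeet_le {D : ℕ} (hD : ∀ v : V, 0 < G.degree v ∧ G.degree v ≤ D)
    {x y : V} (hx : x ∈ B) (hy : y ∈ B) {g : ℝ}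
    (hg : HasSum (fun n => killedHeat G B n x y) g) (L : ℕ) :
    ∑ n ∈ Finset.range L, killedMeet G B n x y ≤ D * g := by
  calc ∑ n ∈ Finset.range L, killedMeet G B n x y
      ≤ ∑ n ∈ Finset.range L, D * killedHeat G B (2 * n) x y :=
        Finset.sum_le_sum fun n _ => killedMeet_le hD n hx hy
    _ = D * ∑ n ∈ (Finset.range L).image (fun n => 2 * n), killedHeat G B n x y := by
        rw [Finset.sum_image fun a _ b _ h => by simpa using h, Finset.mul_sum]
    _ ≤ D * g := mul_le_mul_of_nonneg_left
        (sum_le_hasSum _ (fun n _ => killedHeat_nonneg n x y) hg) (Nat.cast_nonneg _)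

/-- Between vertices of one colour the kernel vanishes at odd times, so even times carry the whole
Green function. The strict `b < g` allows truncation at a finite time. -/
theorem eventually_le_sum_killedMeet {D : ℕ} (hD : ∀ v : V, 0 < G.degree v ∧ G.degree v ≤ D)
    {c : V → ZMod 2} (hc : ∀ v w, G.Adj v w → c w = c v + 1)
    {x y : V} (hx : x ∈ B) (hy : y ∈ B) (hxy : c x = c y) {g b : ℝ}
    (hg : HasSum (fun n => killedHeat G B n x y) g) (hb : b < g) :
    ∀ᶠ L in atTop, b ≤ D * ∑ n ∈ Finset.range L, killedMeet G B n x y := by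
  have hg' : HasSum (fun n => killedHeat G B (2 * n) x y) g := by
    have hinj : Function.Injective fun n : ℕ => 2 * n := fun a b h => by simpa using h
    refine (hinj.hasSum_iff (f := fun n => killedHeat G B n x y) fun n hn => ?_).2 hg
    apply killedHeat_eq_zero_of_parity hc
    intro h
    rw [hxy, left_eq_add, ZMod.natCast_eq_zero_iff] at h
    obtain ⟨k, rfl⟩ := h
    exact hn ⟨k, rfl⟩
  filter_upwards [hg'.tendsto_sum_nat.eventually (lt_mem_nhds hb)] with L hL
  rw [Finset.mul_sum]
  exact hL.le.trans (Finset.sum_le_sum fun n _ => le_killedMeet hD n hx hy)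

end KilledWalk

/-! ### Explicit Green function of the comb, and the growth bound -/

section Comb

/-- Taking `F` on the whole lattice avoids membership proofs. Only vertical neighbours can be
missing: axis neighbours exist because `f ≥ 0`. -/
theorem sum_neighborFinset_wedgeComb {f : ℤ → ℝ} (hf : ∀ x, 0 ≤ f x) (v : combVertices f)
    (F : ℤ × ℤ → ℝ) :
    ∑ w ∈ (wedgeComb f).neighborFinset v, F w.1 =
      (if v.1.2 = 0 then F (v.1.1 + 1, 0) + F (v.1.1 - 1, 0) else 0) +
      (if ((v.1.2 + 1 : ℤ) : ℝ) ≤ f v.1.1 then F (v.1.1, v.1.2 + 1) else 0) +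
      (if -f v.1.1 ≤ ((v.1.2 - 1 : ℤ) : ℝ) then F (v.1.1, v.1.2 - 1) else 0) := by
  classical
  obtain ⟨⟨x, y⟩, hv⟩ := v
  have hv1 : -f x ≤ (y : ℝ) := hv.1
  have hv2 : (y : ℝ) ≤ f x := hv.2
  have key : ((wedgeComb f).neighborFinset ⟨(x, y), hv⟩).map ⟨Subtype.val, Subtype.val_injective⟩ =
      (if y = 0 then {(x + 1, 0), (x - 1, 0)} else ∅) ∪
      ((if ((y + 1 : ℤ) : ℝ) ≤ f x then {(x, y + 1)} else ∅) ∪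
      (if -f x ≤ ((y - 1 : ℤ) : ℝ) then {(x, y - 1)} else ∅)) := by
    ext ⟨a, b⟩
    simp only [Finset.mem_map, SimpleGraph.mem_neighborFinset, Function.Embedding.coeFn_mk,
      Finset.mem_union]
    constructor
    · rintro ⟨⟨⟨a', b'⟩, hw⟩, hadj, h⟩
      simp only [Prod.mk.injEq] at h
      obtain ⟨rfl, rfl⟩ := h
      have hw1 : -f a' ≤ (b' : ℝ) := hw.1
      have hw2 : (b' : ℝ) ≤ f a' := hw.2
      rcases hadj with ⟨h1, h2⟩ | ⟨h1, h2, h3⟩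
      · simp only at h1 h2
        subst h1
        right
        rcases (abs_eq zero_le_one).1 h2 with h | h
        · obtain rfl : b' = y - 1 := by omega
          right
          rw [if_pos hw1]
          simp
        · obtain rfl : b' = y + 1 := by omega
          left
          rw [if_pos hw2]
          simp
      · simp only at h1 h2 h3
        subst h1 h2
        left
        rcases (abs_eq zero_le_one).1 h3 with h | h
        · obtain rfl : a' = x - 1 := by omega
          simp
        · obtain rfl : a' = x + 1 := by omega
          simp
    · rintro (h | h | h)
      · split_ifs at h with h0
        · subst h0
          simp only [Finset.mem_insert, Finset.mem_singleton, Prod.mk.injEq] at h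
          have hb : b = 0 := by tauto
          subst hb
          refine ⟨⟨(a, 0), by simp [combVertices, hf]⟩, Or.inr ⟨rfl, rfl, ?_⟩, rfl⟩
          rcases h with h | h <;> simp [h.1]
        · simp at h
      · split_ifs at h with h0
        · simp only [Finset.mem_singleton, Prod.mk.injEq] at h
          obtain ⟨rfl, rfl⟩ := h
          refine ⟨⟨(a, y + 1), ⟨?_, h0⟩⟩, Or.inl ⟨rfl, by simp⟩, rfl⟩
          push_cast
          linarith
        · simp at h
      · split_ifs at h with h0
        · simp only [Finset.mem_singleton, Prod.mk.injEq] at h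
          obtain ⟨rfl, rfl⟩ := h
          refine ⟨⟨(a, y - 1), ⟨h0, ?_⟩⟩, Or.inl ⟨rfl, by simp⟩, rfl⟩
          push_cast
          linarith
        · simp at h
  have h1 : ∑ w ∈ (wedgeComb f).neighborFinset ⟨(x, y), hv⟩, F w.1 =
      ∑ p ∈ ((wedgeComb f).neighborFinset ⟨(x, y), hv⟩).map
        ⟨Subtype.val, Subtype.val_injective⟩, F p := by
    rw [Finset.sum_map]; rfl
  rw [h1, key, Finset.sum_union, Finset.sum_union, add_assoc]
  · congr 1
    · split_ifs
      · rw [Finset.sum_pair (by simp; omega)]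
      · simp
    · congr 1 <;> split_ifs <;> simp
  · split_ifs <;> simp
    omega
  · split_ifs <;> simp <;> omega

theorem degree_wedgeComb {f : ℤ → ℝ} (hf : ∀ x, 0 ≤ f x) (v : combVertices f) :
    0 < (wedgeComb f).degree v ∧ (wedgeComb f).degree v ≤ 4 := by
  have h := sum_neighborFinset_wedgeComb hf v fun _ => 1
  rw [Finset.sum_const, SimpleGraph.card_neighborFinset_eq_degree, nsmul_eq_mul, mul_one] at h
  have h0 := hf v.1.1
  constructor
  · have : (0 : ℝ) < (wedgeComb f).degree v := by
      rw [h]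
      rcases lt_trichotomy v.1.2 0 with hy | hy | hy
      · have : ((v.1.2 + 1 : ℤ) : ℝ) ≤ f v.1.1 := by
          have : ((v.1.2 + 1 : ℤ) : ℝ) ≤ 0 := by exact_mod_cast hy
          linarith
        rw [if_pos this]
        split_ifs <;> norm_num
      · rw [if_pos hy]
        split_ifs <;> norm_num
      · have : -f v.1.1 ≤ ((v.1.2 - 1 : ℤ) : ℝ) := by
          have : (0 : ℝ) ≤ ((v.1.2 - 1 : ℤ) : ℝ) := by exact_mod_cast (by omega)
          linarith
        rw [if_pos this]
        split_ifs <;> norm_num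
    exact_mod_cast this
  · have : ((wedgeComb f).degree v : ℝ) ≤ 4 := by
      rw [h]
      split_ifs <;> norm_num
    exact_mod_cast this

/-- The part of the comb above `(-R, R)` is finite. -/
theorem combBox_finite (f : ℤ → ℝ) (R : ℕ) : {v : combVertices f | |v.1.1| < R}.Finite := by
  have h : (⋃ x ∈ Set.Ioo (-(R : ℤ)) R, ({x} ×ˢ Set.Icc ⌈-f x⌉ ⌊f x⌋ : Set (ℤ × ℤ))).Finite :=
    (Set.finite_Ioo _ _).biUnion fun x _ => (Set.finite_singleton x).prod (Set.finite_Icc _ _)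
  refine (h.preimage Subtype.val_injective.injOn).subset ?_
  rintro ⟨⟨x, y⟩, hv⟩ hR
  simp only [Set.mem_preimage, Set.mem_iUnion]
  exact ⟨x, abs_lt.1 hR, rfl, Int.ceil_le.2 hv.1, Int.le_floor.2 hv.2⟩

/-- The set of the vertices of the comb with first coordinate in `(-R, R)`. -/
noncomputable def combBox (f : ℤ → ℝ) (R : ℕ) : Finset (combVertices f) :=
  (combBox_finite f R).toFinset

theorem mem_combBox {f : ℤ → ℝ} {R : ℕ} {v : combVertices f} :
    v ∈ combBox f R ↔ |v.1.1| < R := by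
  simp [combBox]

theorem combBox_mono (f : ℤ → ℝ) {R R' : ℕ} (h : R ≤ R') : combBox f R ⊆ combBox f R' := by
  intro v hv
  rw [mem_combBox] at *
  exact hv.trans_le (by exact_mod_cast h)

/-- The length of the common part of the paths from the base of a tooth to the heights `m`, `n`. -/
def toothMeet (m n : ℤ) : ℤ := max 0 (min m n) + max 0 (min (-m) (-n))

theorem toothMeet_nonneg (m n : ℤ) : 0 ≤ toothMeet m n := by
  unfold toothMeet; positivity

theorem toothMeet_le (m n : ℤ) : toothMeet m n ≤ |m| := by
  unfold toothMeet
  have := le_abs_self m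
  have := neg_le_abs m
  omega

/-- The voltage at `p` when a unit current enters the comb at `q` and leaves at the lines
`x = ± R`. -/
noncomputable def combVoltage (R : ℕ) (q p : ℤ × ℤ) : ℝ :=
  ((R : ℝ) ^ 2 - p.1 * q.1 - R * |(p.1 : ℝ) - q.1|) / (2 * R) +
    if p.1 = q.1 then (toothMeet p.2 q.2 : ℝ) else 0

theorem base_voltage_eq (R a b : ℝ) :
    R ^ 2 - a * b - R * |a - b| = (R + min a b) * (R - max a b) := by
  rcases le_total a b with h | h
  · rw [min_eq_left h, max_eq_right h, abs_of_nonpos (by linarith)]; ring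
  · rw [min_eq_right h, max_eq_left h, abs_of_nonneg (by linarith)]; ring

theorem combVoltage_nonneg {R : ℕ} {p q : ℤ × ℤ} (hp : |p.1| < R) (hq : |q.1| < R) :
    0 ≤ combVoltage R q p := by
  have hp' : |(p.1 : ℝ)| < R := by exact_mod_cast hp
  have hq' : |(q.1 : ℝ)| < R := by exact_mod_cast hq
  rw [abs_lt] at hp' hq'
  unfold combVoltage
  rw [base_voltage_eq]
  refine add_nonneg (div_nonneg (mul_nonneg ?_ ?_) (by positivity)) ?_
  · have := lt_min hp'.1 hq'.1; linarith
  · have := max_lt hp'.2 hq'.2; linarith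
  · split_ifs
    · exact_mod_cast toothMeet_nonneg _ _
    · exact le_rfl

/-- The tooth term is at most the height of either argument; bounding it by that of `p` alone leaves
the height of `q` unconstrained. -/
theorem combVoltage_le {R : ℕ} {p q : ℤ × ℤ} (hp : |p.1| < R) (hq : |q.1| < R) :
    combVoltage R q p ≤ R + |(p.2 : ℝ)| := by
  have hR : (0 : ℝ) < R := by exact_mod_cast (abs_nonneg _).trans_lt hp
  have hp' : |(p.1 : ℝ)| < R := by exact_mod_cast hp
  have hq' : |(q.1 : ℝ)| < R := by exact_mod_cast hq
  unfold combVoltage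
  refine add_le_add ?_ ?_
  · rw [div_le_iff₀ (by positivity)]
    have h1 : |(p.1 : ℝ) * q.1| ≤ R * R := by
      rw [abs_mul]; gcongr
    have h2 := neg_le_of_abs_le h1
    have h3 : 0 ≤ R * |(p.1 : ℝ) - q.1| := by positivity
    nlinarith
  · split_ifs
    · exact_mod_cast toothMeet_le _ _
    · positivity

theorem le_combVoltage {R : ℕ} (hR : 0 < R) {p q : ℤ × ℤ} (hp : 2 * |p.1| ≤ R)
    (hq : 2 * |q.1| ≤ R) : (R : ℝ) / 8 ≤ combVoltage R q p := by
  have hR : (0 : ℝ) < R := by exact_mod_cast hR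
  have hp' : 2 * |(p.1 : ℝ)| ≤ R := by exact_mod_cast hp
  have hq' : 2 * |(q.1 : ℝ)| ≤ R := by exact_mod_cast hq
  have hp1 := abs_le.1 (show |(p.1 : ℝ)| ≤ R / 2 by linarith)
  have hq1 := abs_le.1 (show |(q.1 : ℝ)| ≤ R / 2 by linarith)
  unfold combVoltage
  rw [base_voltage_eq]
  have h1 : (R : ℝ) / 8 ≤
      ((R : ℝ) + min (p.1 : ℝ) q.1) * (R - max (p.1 : ℝ) q.1) / (2 * R) := by
    rw [le_div_iff₀ (by positivity)]
    have h1 := le_min hp1.1 hq1.1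
    have h2 := max_le hp1.2 hq1.2
    calc (R : ℝ) / 8 * (2 * R) = (R / 2) * (R / 2) := by ring
      _ ≤ _ := by gcongr <;> linarith
  have h2 : (0 : ℝ) ≤ if p.1 = q.1 then (toothMeet p.2 q.2 : ℝ) else 0 := by
    split_ifs
    · exact_mod_cast toothMeet_nonneg _ _
    · exact le_rfl
  linarith

theorem combVoltage_boundary {R : ℕ} (hR : 0 < R) {p q : ℤ × ℤ} (hp : |p.1| = R)
    (hq : |q.1| < R) : combVoltage R q p = 0 := by
  have hpq : p.1 ≠ q.1 := by rintro h; rw [h] at hp; omega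
  have hR' : (R : ℝ) ≠ 0 := by exact_mod_cast hR.ne'
  have hq' : |(q.1 : ℝ)| < R := by exact_mod_cast hq
  rw [abs_lt] at hq'
  unfold combVoltage
  rw [if_neg hpq, add_zero]
  rcases (abs_eq (by positivity)).1 hp with h | h
  · rw [h, abs_of_nonneg (by push_cast; linarith)]; push_cast; ring
  · rw [h, abs_of_nonpos (by push_cast; linarith)]; push_cast; ring

theorem abs_second_difference (a : ℤ) :
    |((a + 1 : ℤ) : ℝ)| + |((a - 1 : ℤ) : ℝ)| - 2 * |(a : ℝ)| = if a = 0 then 2 else 0 := by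
  have h : |a + 1| + |a - 1| - 2 * |a| = if a = 0 then 2 else 0 := by
    rcases abs_cases (a + 1) with h1 | h1 <;> rcases abs_cases (a - 1) with h2 | h2 <;>
      rcases abs_cases a with h3 | h3 <;> split_ifs <;> omega
  exact_mod_cast h

/-- Kirchhoff's law for the unit current entering at `q`: it runs down the tooth of `q` to the axis
and out at both ends. The kernel at time 0 serves only as the indicator of `v = q`, whence the empty
set. -/
theorem sum_combVoltage_sub {f : ℤ → ℝ} (hf : ∀ x, 0 ≤ f x) {R : ℕ} (hR : 0 < R)
    (q v : combVertices f) :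
    ∑ w ∈ (wedgeComb f).neighborFinset v, (combVoltage R q.1 v.1 - combVoltage R q.1 w.1) =
      killedHeat (wedgeComb f) ∅ 0 v q := by
  rw [sum_neighborFinset_wedgeComb hf v fun w => combVoltage R q.1 v.1 - combVoltage R q.1 w]
  obtain ⟨⟨a, m⟩, hv⟩ := v
  obtain ⟨⟨b, n⟩, hq⟩ := q
  have hv1 : -f a ≤ (m : ℝ) := hv.1
  have hv2 : (m : ℝ) ≤ f a := hv.2
  have hq1 : -f b ≤ (n : ℝ) := hq.1
  have hq2 : (n : ℝ) ≤ f b := hq.2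
  have ha := hf a
  have hR' : (R : ℝ) ≠ 0 := by exact_mod_cast hR.ne'
  simp only [killedHeat, Subtype.mk.injEq, Prod.mk.injEq]
  -- Beyond the end of a tooth the voltage formula is constant, since the source cannot lie there.
  -- The missing edge may thus be counted as carrying no current.
  have up : (if ((m + 1 : ℤ) : ℝ) ≤ f a then combVoltage R (b, n) (a, m) -
      combVoltage R (b, n) (a, m + 1) else 0) =
      if a = b then ((toothMeet m n - toothMeet (m + 1) n : ℤ) : ℝ) else 0 := by
    by_cases hab : a = b
    · subst hab
      rw [if_pos (rfl : a = a)]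
      split_ifs with h
      · simp [combVoltage]
      · rw [eq_comm]
        have h1 : n < m + 1 := by
          have : (n : ℝ) < ((m + 1 : ℤ) : ℝ) := by linarith
          exact_mod_cast this
        have h2 : 0 < m + 1 := by
          have : (0 : ℝ) < ((m + 1 : ℤ) : ℝ) := by linarith
          exact_mod_cast this
        have : toothMeet m n - toothMeet (m + 1) n = 0 := by unfold toothMeet; omega
        exact_mod_cast this
    · simp [combVoltage, hab]
  have down : (if -f a ≤ ((m - 1 : ℤ) : ℝ) then combVoltage R (b, n) (a, m) -
      combVoltage R (b, n) (a, m - 1) else 0) =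
      if a = b then ((toothMeet m n - toothMeet (m - 1) n : ℤ) : ℝ) else 0 := by
    by_cases hab : a = b
    · subst hab
      rw [if_pos (rfl : a = a)]
      split_ifs with h
      · simp [combVoltage]
      · rw [eq_comm]
        have h1 : m - 1 < n := by
          have : ((m - 1 : ℤ) : ℝ) < n := by linarith
          exact_mod_cast this
        have h2 : m - 1 < 0 := by
          have : ((m - 1 : ℤ) : ℝ) < 0 := by linarith
          exact_mod_cast this
        have : toothMeet m n - toothMeet (m - 1) n = 0 := by unfold toothMeet; omega
        exact_mod_cast this
    · simp [combVoltage, hab]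
  rw [up, down]
  have hor : m = 0 → combVoltage R (b, n) (a, m) - combVoltage R (b, n) (a + 1, 0) +
      (combVoltage R (b, n) (a, m) - combVoltage R (b, n) (a - 1, 0)) =
      if a = b then 1 else 0 := by
    rintro rfl
    have h0 : toothMeet 0 n = 0 := by unfold toothMeet; omega
    have h1 := abs_second_difference (a - b)
    unfold combVoltage
    simp only [h0, Int.cast_zero, ite_self, add_zero]
    have e1 : ((a - b + 1 : ℤ) : ℝ) = ((a + 1 : ℤ) : ℝ) - b := by push_cast; ring
    have e2 : ((a - b - 1 : ℤ) : ℝ) = ((a - 1 : ℤ) : ℝ) - b := by push_cast; ring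
    have e3 : ((a - b : ℤ) : ℝ) = (a : ℝ) - b := by push_cast; ring
    rw [e1, e2, e3] at h1
    have e4 : (if a - b = 0 then (2 : ℝ) else 0) = 2 * if a = b then 1 else 0 := by
      simp [sub_eq_zero]
    rw [e4] at h1
    rw [show (if a = b then (1 : ℝ) else 0) = (|((a + 1 : ℤ) : ℝ) - b| + |((a - 1 : ℤ) : ℝ) - b|
      - 2 * |(a : ℝ) - b|) / 2 by linarith]
    field_simp
    push_cast
    ring
  by_cases hm : m = 0
  · rw [if_pos hm, hor hm]
    by_cases hab : a = b
    · simp only [hab, true_and, if_true]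
      have : 1 + (toothMeet m n - toothMeet (m + 1) n) + (toothMeet m n - toothMeet (m - 1) n) =
          if m = n then 1 else 0 := by
        unfold toothMeet; split_ifs <;> omega
      exact_mod_cast this
    · simp [hab]
  · rw [if_neg hm]
    by_cases hab : a = b
    · simp only [hab, true_and, if_true]
      have : 0 + (toothMeet m n - toothMeet (m + 1) n) + (toothMeet m n - toothMeet (m - 1) n) =
          if m = n then 1 else 0 := by
        unfold toothMeet; split_ifs <;> omega
      exact_mod_cast this
    · simp [hab]

/-- The Green function of the walk on the comb killed on leaving a box. -/
theorem hasSum_killedHeat_combBox {f : ℤ → ℝ} (hf : ∀ x, 0 ≤ f x) {R : ℕ}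
    {x y : combVertices f} (hx : x ∈ combBox f R) (hy : y ∈ combBox f R) :
    HasSum (fun n => killedHeat (wedgeComb f) (combBox f R) n x y)
      ((wedgeComb f).degree y * combVoltage R y.1 x.1) := by
  have hR : 0 < R := by
    have := (abs_nonneg _).trans_lt (mem_combBox.1 hx)
    exact_mod_cast this
  -- The factor `degree y` converts the unit-conductance Laplacian into the normalised one of the
  -- walk.
  refine hasSum_killedHeat (h := fun y x => (wedgeComb f).degree y * combVoltage R y.1 x.1)
    (fun y hy x hx => mul_nonneg (Nat.cast_nonneg _)
      (combVoltage_nonneg (mem_combBox.1 hx) (mem_combBox.1 hy))) (fun y hy x hx => ?_) hx hy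
  have hd : ((wedgeComb f).degree x : ℝ) ≠ 0 := by exact_mod_cast (degree_wedgeComb hf x).1.ne'
  rw [sum_srwStep_mul]
  · have h := sum_combVoltage_sub hf hR y x
    rw [Finset.sum_sub_distrib, Finset.sum_const, SimpleGraph.card_neighborFinset_eq_degree,
      nsmul_eq_mul] at h
    rw [← Finset.mul_sum]
    have h2 : ∑ w ∈ (wedgeComb f).neighborFinset x, combVoltage R y.1 w.1 =
      (wedgeComb f).degree x * combVoltage R y.1 x.1 - killedHeat (wedgeComb f) ∅ 0 x y := by
      linarith
    rw [h2]
    by_cases hxy : x = y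
    · subst hxy
      simp only [killedHeat, if_true]
      field_simp
      ring
    · simp only [killedHeat, hxy, if_false]
      field_simp
      ring
  -- A neighbour outside the box lies on `x = ± R`, where the voltage is 0.
  · intro w hw hwB
    rw [mem_combBox] at hx hwB
    rw [combVoltage_boundary hR _ (mem_combBox.1 hy), mul_zero]
    rcases hw with ⟨h, -⟩ | ⟨-, -, h⟩
    · rw [h] at hx; exact absurd hx hwB
    · have := abs_sub_abs_le_abs_sub w.1.1 x.1.1
      rw [abs_sub_comm] at this
      omega

/-- The colour of a vertex in the bipartition of the comb. -/
def combParity {f : ℤ → ℝ} (v : combVertices f) : ZMod 2 := ((v.1.1 + v.1.2 : ℤ) : ZMod 2)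

theorem combParity_adj {f : ℤ → ℝ} (v w : combVertices f) (h : (wedgeComb f).Adj v w) :
    combParity w = combParity v + 1 := by
  unfold combParity
  have : ((w.1.1 + w.1.2 : ℤ) : ZMod 2) = ((v.1.1 + v.1.2 + 1 : ℤ) : ZMod 2) := by
    rw [ZMod.intCast_eq_intCast_iff_dvd_sub]
    rcases h with ⟨h1, h2⟩ | ⟨h1, h2, h3⟩
    · rcases (abs_eq zero_le_one).1 h2 with h | h <;> push_cast <;> omega
    · rcases (abs_eq zero_le_one).1 h3 with h | h <;> push_cast <;> omega
  rw [this]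
  push_cast
  ring

/-- A growth bound `O(n log n)` controls the profile on dyadic intervals. -/
theorem exists_profile_bound {f : ℤ → ℝ} (hf : ∀ x, 0 ≤ f x)
    (hO : (fun n : ℕ => f (-(n : ℤ)) + f (n : ℤ)) =O[atTop]
      fun n : ℕ => (n : ℝ) * Real.log (n : ℝ)) :
    ∃ A : ℝ, 0 ≤ A ∧ ∀ i : ℕ, 1 ≤ i → ∀ x : ℤ, |x| < (2 ^ i : ℕ) → f x ≤ A * (i * 2 ^ i) := by
  obtain ⟨C, hC⟩ := hO.bound
  obtain ⟨N, hN⟩ := eventually_atTop.1 hC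
  set M := ∑ n ∈ Finset.range N, (f (-(n : ℤ)) + f (n : ℤ)) with hM
  have hM0 : 0 ≤ M := Finset.sum_nonneg fun n _ => add_nonneg (hf _) (hf _)
  -- `C` handles large `n`; `M` absorbs the finitely many `n < N`, as `i * 2 ^ i ≥ 1`.
  refine ⟨|C| + M, by positivity, fun i hi x hx => ?_⟩
  set n := x.natAbs with hn
  have hfx : f x ≤ f (-(n : ℤ)) + f (n : ℤ) := by
    have h1 := hf (-(n : ℤ))
    have h2 := hf (n : ℤ)
    rcases Int.natAbs_eq x with h | h
    · rw [← hn] at h; rw [h]; linarith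
    · rw [← hn] at h; rw [h]; linarith
  have hn2 : n < 2 ^ i := by
    rw [Int.abs_eq_natAbs] at hx
    exact_mod_cast hx
  have hi1 : (1 : ℝ) ≤ i := by exact_mod_cast hi
  have h2i : (1 : ℝ) ≤ 2 ^ i := one_le_pow₀ (by norm_num)
  have h3 : (1 : ℝ) ≤ i * 2 ^ i := one_le_mul_of_one_le_of_one_le hi1 h2i
  refine hfx.trans ?_
  by_cases hnN : n < N
  · calc f (-(n : ℤ)) + f (n : ℤ) ≤ M :=
        Finset.single_le_sum (f := fun n : ℕ => f (-(n : ℤ)) + f (n : ℤ))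
          (fun n _ => add_nonneg (hf _) (hf _)) (Finset.mem_range.2 hnN)
      _ ≤ M * (i * 2 ^ i) := le_mul_of_one_le_right hM0 h3
      _ ≤ _ := by gcongr; linarith [abs_nonneg C]
  · have h4 := hN n (not_lt.1 hnN)
    have hlog0 : 0 ≤ Real.log n := Real.log_natCast_nonneg n
    rw [Real.norm_of_nonneg (add_nonneg (hf _) (hf _)), Real.norm_of_nonneg (by positivity)] at h4
    have hn3 : (n : ℝ) ≤ 2 ^ i := by exact_mod_cast hn2.le
    have hlog : Real.log n ≤ i := by
      rcases Nat.eq_zero_or_pos n with h | h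
      · rw [h]; simp
      · calc Real.log n ≤ Real.log (2 ^ i) := Real.log_le_log (by exact_mod_cast h) hn3
          _ = i * Real.log 2 := Real.log_pow _ _
          _ ≤ i * 1 := by gcongr; linarith [Real.log_two_lt_d9]
          _ = i := mul_one _
    calc f (-(n : ℤ)) + f (n : ℤ) ≤ C * (n * Real.log n) := h4
      _ ≤ |C| * (2 ^ i * i) := by gcongr; exact le_abs_self C
      _ = |C| * (i * 2 ^ i) := by ring
      _ ≤ _ := by gcongr; linarith

end Comb

/-! ### The past of a process -/

section Past

/-- The `σ`-algebra generated by a process up to time `m`. -/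
abbrev pastSigma {Ω S : Type*} [MeasurableSpace S] (W : ℕ → Ω → S) (m : ℕ) : MeasurableSpace Ω :=
  MeasurableSpace.comap (fun ω (i : Fin (m + 1)) => W i ω) MeasurableSpace.pi

theorem measurable_pastSigma {Ω S : Type*} [MeasurableSpace S] (W : ℕ → Ω → S) {i m : ℕ}
    (h : i ≤ m) : Measurable[pastSigma W m] (W i) := by
  have h1 : Measurable[pastSigma W m] (fun ω (i : Fin (m + 1)) => W i ω) :=
    comap_measurable _
  exact (measurable_pi_apply (⟨i, Nat.lt_succ_of_le h⟩ : Fin (m + 1))).comp h1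

theorem pastSigma_mono {Ω S : Type*} [MeasurableSpace S] (W : ℕ → Ω → S) {m n : ℕ} (h : m ≤ n) :
    pastSigma W m ≤ pastSigma W n :=
  Measurable.comap_le (@measurable_pi_iff _ _ _ (pastSigma W n) _ _|>.2
    fun i => measurable_pastSigma W (by omega))

theorem pastSigma_le {Ω S : Type*} [MeasurableSpace Ω] [MeasurableSpace S] {W : ℕ → Ω → S}
    (hW : ∀ n, Measurable (W n)) (m : ℕ) : pastSigma W m ≤ ‹MeasurableSpace Ω› :=
  Measurable.comap_le (measurable_pi_iff.2 fun i => hW i)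

end Past

/-! ### Two independent walks as one Markov chain -/

section WalkPair

variable {V : Type*} [MeasurableSpace V] {Ω : Type*} [MeasurableSpace Ω]

/-- `W` is a pair of independent simple random walks on `G`, viewed as a Markov chain. -/
structure IsWalkPair (G : SimpleGraph V) [G.LocallyFinite] (μ : Measure Ω) (W : ℕ → Ω → V × V) :
    Prop where
  measurable : ∀ n, Measurable (W n)
  markov : ∀ (n : ℕ) (γ : ℕ → V × V) (t : V × V),
    μ.real {ω | (∀ i ≤ n, W i ω = γ i) ∧ W (n + 1) ω = t} =
      μ.real {ω | ∀ i ≤ n, W i ω = γ i} * (srwStep G (γ n).1 t.1 * srwStep G (γ n).2 t.2)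

theorem IsSimpleRandomWalk.isWalkPair [MeasurableSingletonClass V] {G : SimpleGraph V}
    [G.LocallyFinite] {o o' : V} {μ : Measure Ω} {X X' : ℕ → Ω → V}
    (hX : IsSimpleRandomWalk G o μ X) (hX' : IsSimpleRandomWalk G o' μ X')
    (h : IndepFun (fun ω n => X n ω) (fun ω n => X' n ω) μ) :
    IsWalkPair G μ fun n ω => (X n ω, X' n ω) := by
  refine ⟨fun n => (hX.measurable n).prodMk (hX'.measurable n), fun n γ t => ?_⟩
  have hind : ∀ s s' : Set (ℕ → V), MeasurableSet s → MeasurableSet s' →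
      μ.real {ω | (fun n => X n ω) ∈ s ∧ (fun n => X' n ω) ∈ s'} =
        μ.real {ω | (fun n => X n ω) ∈ s} * μ.real {ω | (fun n => X' n ω) ∈ s'} := by
    intro s s' hs hs'
    have := h.measure_inter_preimage_eq_mul s s' hs hs'
    simp only [Measure.real]
    rw [← ENNReal.toReal_mul]
    exact congrArg ENNReal.toReal this
  have hpt : ∀ (i : ℕ) (w : V), MeasurableSet {p : ℕ → V | p i = w} := fun i w => by
    have : Measurable fun p : ℕ → V => p i := measurable_pi_apply i
    exact this (measurableSet_singleton w)
  have hcyl : ∀ γ : ℕ → V, MeasurableSet {p : ℕ → V | ∀ i ≤ n, p i = γ i} := fun γ => by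
    simp only [Set.ofPred_forall]
    exact MeasurableSet.iInter fun i => MeasurableSet.iInter fun _ => hpt i (γ i)
  have hcyl' : ∀ (γ : ℕ → V) (w : V),
      MeasurableSet {p : ℕ → V | (∀ i ≤ n, p i = γ i) ∧ p (n + 1) = w} := fun γ w =>
    (hcyl γ).inter (hpt (n + 1) w)
  have h1 := hind _ _ (hcyl fun i => (γ i).1) (hcyl fun i => (γ i).2)
  have h2 := hind _ _ (hcyl' (fun i => (γ i).1) t.1) (hcyl' (fun i => (γ i).2) t.2)
  simp only [Set.mem_ofPred_eq] at h1 h2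
  have e1 : {ω | ∀ i ≤ n, (X i ω, X' i ω) = γ i} =
      {ω | (∀ i ≤ n, X i ω = (γ i).1) ∧ ∀ i ≤ n, X' i ω = (γ i).2} := by
    ext ω; simp only [Prod.ext_iff, Set.mem_ofPred_eq]; grind
  have e2 : {ω | (∀ i ≤ n, (X i ω, X' i ω) = γ i) ∧ (X (n + 1) ω, X' (n + 1) ω) = t} =
      {ω | ((∀ i ≤ n, X i ω = (γ i).1) ∧ X (n + 1) ω = t.1) ∧
        (∀ i ≤ n, X' i ω = (γ i).2) ∧ X' (n + 1) ω = t.2} := by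
    ext ω; simp only [Prod.ext_iff, Set.mem_ofPred_eq]; grind
  rw [e1, e2, h1, h2, hX.markov n (fun i => (γ i).1) t.1, hX'.markov n (fun i => (γ i).2) t.2]
  ring

variable {G : SimpleGraph V} [G.LocallyFinite] {μ : Measure Ω} [IsFiniteMeasure μ]
  {W : ℕ → Ω → V × V} [Countable V] [MeasurableSingletonClass V]

/-- Extends the Markov property from single trajectories to arbitrary past events on which the
present state is `s`. -/
theorem IsWalkPair.measureReal_inter_step (hW : IsWalkPair G μ W) {m : ℕ} {E : Set Ω}
    (hE : MeasurableSet[pastSigma W m] E) {s : V × V} (hs : E ⊆ {ω | W m ω = s}) (t : V × V) :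
    μ.real (E ∩ {ω | W (m + 1) ω = t}) =
      μ.real E * (srwStep G s.1 t.1 * srwStep G s.2 t.2) := by
  obtain ⟨D, hD, rfl⟩ := hE
  set path : Ω → (Fin (m + 1) → V × V) := fun ω i => W i ω with hpath
  have hpm : Measurable path := measurable_pi_iff.2 fun i => hW.measurable i
  set q := srwStep G s.1 t.1 * srwStep G s.2 t.2 with hq
  have hq0 : 0 ≤ q := mul_nonneg (srwStep_nonneg _ _ _) (srwStep_nonneg _ _ _)
  set T : Set Ω := {ω | W (m + 1) ω = t} with hT
  have hTm : MeasurableSet T := hW.measurable (m + 1) (measurableSet_singleton t)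
  set U : Set (Fin (m + 1) → V × V) := {d | d (Fin.last m) = s} with hU
  have hUm : MeasurableSet U := by
    have : Measurable fun d : Fin (m + 1) → V × V => d (Fin.last m) := measurable_pi_apply _
    exact this (measurableSet_singleton s)
  -- The space of initial trajectories is countable, so the two measures need only be compared on
  -- singletons, where this is the defining Markov property.
  have key : ((μ.restrict T).map path).restrict U =
      ENNReal.ofReal q • (μ.map path).restrict U := by
    refine Measure.ext_of_singleton fun d => ?_
    have hd := measurableSet_singleton d
    rw [Measure.smul_apply, Measure.restrict_apply hd, Measure.restrict_apply hd]
    by_cases hdU : d ∈ U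
    · rw [Set.inter_eq_left.2 (Set.singleton_subset_iff.2 hdU), Measure.map_apply hpm hd,
        Measure.map_apply hpm hd, Measure.restrict_apply (hpm hd)]
      have h := hW.markov m (fun i => if h : i < m + 1 then d ⟨i, h⟩ else s) t
      have e : ∀ ω, path ω = d ↔
          ∀ i ≤ m, W i ω = if h : i < m + 1 then d ⟨i, h⟩ else s := by
        intro ω
        constructor
        · rintro rfl i hi
          simp [hpath, Nat.lt_succ_of_le hi]
        · intro h
          ext1 i
          have := h i (Nat.le_of_lt_succ i.2)
          rwa [dif_pos i.2] at this
      have hlast : (if h : m < m + 1 then d ⟨m, h⟩ else s) = s := by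
        rw [dif_pos (Nat.lt_succ_self m)]
        exact hdU
      rw [hlast] at h
      have e1 : path ⁻¹' {d} ∩ T = {ω | (∀ i ≤ m, W i ω = if h : i < m + 1 then d ⟨i, h⟩ else s) ∧
          W (m + 1) ω = t} := by
        ext ω
        simp only [Set.mem_inter_iff, Set.mem_preimage, Set.mem_singleton_iff, e ω]
        rfl
      have e2 : path ⁻¹' {d} = {ω | ∀ i ≤ m, W i ω = if h : i < m + 1 then d ⟨i, h⟩ else s} := by
        ext ω
        simp only [Set.mem_preimage, Set.mem_singleton_iff, e ω]
        rfl
      rw [← e1, ← e2, mul_comm] at h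
      rw [← ENNReal.ofReal_toReal (measure_ne_top μ (path ⁻¹' {d} ∩ T)),
        ← ENNReal.ofReal_toReal (measure_ne_top μ (path ⁻¹' {d})), smul_eq_mul,
        ← ENNReal.ofReal_mul hq0]
      exact congrArg ENNReal.ofReal h
    · rw [Set.singleton_inter_eq_empty.2 hdU]
      simp
  have hDU : path ⁻¹' (D ∩ U) = path ⁻¹' D := by
    rw [Set.preimage_inter]
    exact Set.inter_eq_left.2 hs
  have h := congrArg (fun ν => ν D) key
  simp only [Measure.smul_apply, Measure.restrict_apply hD] at h
  rw [Measure.map_apply hpm (hD.inter hUm), Measure.map_apply hpm (hD.inter hUm), hDU,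
    Measure.restrict_apply (hpm hD)] at h
  rw [Measure.real, Measure.real, h, smul_eq_mul, ENNReal.toReal_mul, ENNReal.toReal_ofReal hq0,
    mul_comm]

/-- Both walkers are in `B` at all times in `(m, m + n]`. -/
def pairStays (W : ℕ → Ω → V × V) (B : Finset V) (m n : ℕ) : Set Ω :=
  {ω | ∀ i, m < i → i ≤ m + n → (W i ω).1 ∈ B ∧ (W i ω).2 ∈ B}

/-- Both walkers are in `B` at all times in `(m, m + n]`, and meet at time `m + n`. -/
def pairMeets (W : ℕ → Ω → V × V) (B : Finset V) (m n : ℕ) : Set Ω :=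
  pairStays W B m n ∩ {ω | (W (m + n) ω).1 = (W (m + n) ω).2}

end WalkPair

theorem inter_pairMeets {V Ω : Type*} {W : ℕ → Ω → V × V} {B : Finset V} {m n : ℕ} {E : Set Ω} {x y : V}
    (hs : E ⊆ {ω | W m ω = (x, y)}) (hx : x ∈ B) :
    E ∩ pairMeets W B m n =
      ⋃ v ∈ B, E ∩ pairStays W B m n ∩ {ω | W (m + n) ω = (v, v)} := by
  ext ω
  simp only [pairMeets, Set.mem_inter_iff, Set.mem_ofPred_eq, Set.mem_iUnion, exists_prop]
  constructor
  · rintro ⟨h1, h2, h3⟩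
    refine ⟨(W (m + n) ω).1, ?_, ⟨h1, h2⟩, Prod.ext rfl h3.symm⟩
    rcases Nat.eq_zero_or_pos n with rfl | hn
    · have : W m ω = (x, y) := hs h1
      rw [add_zero, this]
      exact hx
    · exact (h2 (m + n) (by omega) le_rfl).1
  · rintro ⟨v, hv, ⟨h1, h2⟩, h3⟩
    exact ⟨h1, h2, by rw [h3]⟩

/-! ### Confined walks, and first and second moments of meetings -/

section WalkPair

variable {V : Type*} [MeasurableSpace V] [Countable V] [MeasurableSingletonClass V]

theorem measurableSet_pairStays {Ω : Type*} (W : ℕ → Ω → V × V) (B : Finset V) (m n : ℕ) :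
    MeasurableSet[pastSigma W (m + n)] (pairStays W B m n) := by
  simp only [pairStays, Set.ofPred_forall]
  exact MeasurableSet.iInter fun i => MeasurableSet.iInter fun _ => MeasurableSet.iInter fun hi =>
    measurable_pastSigma W hi (MeasurableSet.of_discrete (s := {p : V × V | p.1 ∈ B ∧ p.2 ∈ B}))

theorem measurableSet_pairMeets {Ω : Type*} (W : ℕ → Ω → V × V) (B : Finset V) (m n : ℕ) :
    MeasurableSet[pastSigma W (m + n)] (pairMeets W B m n) :=
  (measurableSet_pairStays W B m n).inter (measurable_pastSigma W le_rfl
    (MeasurableSet.of_discrete (s := {p : V × V | p.1 = p.2})))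

variable {Ω : Type*} [MeasurableSpace Ω] {G : SimpleGraph V} [G.LocallyFinite] {μ : Measure Ω}
  [IsFiniteMeasure μ] {W : ℕ → Ω → V × V}

/-- Induction on `n` by splitting at the first step, with `m` and `E` varying. The confinement
starts strictly after time `m`, matching the kernel, which does not test its starting point. -/
theorem IsWalkPair.measureReal_inter_pairStays (hW : IsWalkPair G μ W) (B : Finset V) (n : ℕ)
    {m : ℕ} {E : Set Ω} (hE : MeasurableSet[pastSigma W m] E) {x y : V}
    (hs : E ⊆ {ω | W m ω = (x, y)}) (u v : V) :
    μ.real (E ∩ pairStays W B m n ∩ {ω | W (m + n) ω = (u, v)}) =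
      μ.real E * (killedHeat G B n x u * killedHeat G B n y v) := by
  induction n generalizing m E x y with
  | zero =>
    have h1 : pairStays W B m 0 = Set.univ := by
      ext ω
      simp only [pairStays, Set.mem_ofPred_eq, Set.mem_univ, iff_true]
      intro i hi hi'
      omega
    rw [h1, Set.inter_univ, killedHeat, killedHeat]
    by_cases hxy : x = u ∧ y = v
    · rw [Set.inter_eq_left.2 (by rw [← hxy.1, ← hxy.2]; exact hs), if_pos hxy.1, if_pos hxy.2]
      ring
    · have : E ∩ {ω | W (m + 0) ω = (u, v)} = ∅ := by
        rw [Set.eq_empty_iff_forall_notMem]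
        rintro ω ⟨h1, h2⟩
        have h3 : W m ω = (x, y) := hs h1
        have h2 : W m ω = (u, v) := h2
        rw [h3, Prod.mk.injEq] at h2
        exact hxy h2
      rw [this, measureReal_empty]
      rcases not_and_or.1 hxy with h | h <;> simp [h]
  | succ n ih =>
    have hset : E ∩ pairStays W B m (n + 1) ∩ {ω | W (m + (n + 1)) ω = (u, v)} =
        ⋃ t ∈ B ×ˢ B, (E ∩ {ω | W (m + 1) ω = t}) ∩ pairStays W B (m + 1) n ∩
          {ω | W (m + 1 + n) ω = (u, v)} := by
      ext ω
      simp only [pairStays, Set.mem_inter_iff, Set.mem_ofPred_eq, Set.mem_iUnion,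
        Finset.mem_product, exists_prop]
      rw [show m + (n + 1) = m + 1 + n by ring]
      constructor
      · rintro ⟨⟨h1, h2⟩, h3⟩
        exact ⟨W (m + 1) ω, h2 _ (by omega) (by omega), ⟨⟨h1, rfl⟩,
          fun i hi hi' => h2 i (by omega) hi'⟩, h3⟩
      · rintro ⟨t, ht, ⟨⟨h1, h4⟩, h2⟩, h3⟩
        refine ⟨⟨h1, fun i hi hi' => ?_⟩, h3⟩
        rcases Nat.lt_or_ge (m + 1) i with h | h
        · exact h2 i h hi'
        · obtain rfl : i = m + 1 := by omega
          rw [h4]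
          exact ht
    have hEt : ∀ t, MeasurableSet[pastSigma W (m + 1)] (E ∩ {ω | W (m + 1) ω = t}) := fun t =>
      (pastSigma_mono W (Nat.le_succ m) _ hE).inter
        (measurable_pastSigma W le_rfl (measurableSet_singleton t))
    rw [hset, measureReal_biUnion_finset]
    · rw [Finset.sum_product, killedHeat, killedHeat, Finset.sum_mul_sum, Finset.mul_sum]
      refine Finset.sum_congr rfl fun a _ => ?_
      rw [Finset.mul_sum]
      refine Finset.sum_congr rfl fun b _ => ?_
      rw [ih (hEt (a, b)) Set.inter_subset_right, hW.measureReal_inter_step hE hs]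
      ring
    · intro t _ t' _ htt'
      refine Set.disjoint_left.2 ?_
      rintro ω ⟨⟨⟨_, h1⟩, _⟩, _⟩ ⟨⟨⟨_, h2⟩, _⟩, _⟩
      exact htt' (h1.symm.trans h2)
    · intro t _
      refine MeasurableSet.inter (MeasurableSet.inter ?_ ?_) ?_
      · exact pastSigma_le hW.measurable _ _ (hEt t)
      · exact pastSigma_le hW.measurable _ _ (measurableSet_pairStays W B _ n)
      · exact hW.measurable _ (measurableSet_singleton (u, v))

theorem IsWalkPair.measureReal_inter_pairMeets (hW : IsWalkPair G μ W) {B : Finset V} (n : ℕ)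
    {m : ℕ} {E : Set Ω} (hE : MeasurableSet[pastSigma W m] E) {x y : V}
    (hs : E ⊆ {ω | W m ω = (x, y)}) (hx : x ∈ B) :
    μ.real (E ∩ pairMeets W B m n) = μ.real E * killedMeet G B n x y := by
  rw [inter_pairMeets hs hx, measureReal_biUnion_finset, killedMeet, Finset.mul_sum]
  · exact Finset.sum_congr rfl fun v _ => hW.measureReal_inter_pairStays B n hE hs v v
  · intro t _ t' _ htt'
    refine Set.disjoint_left.2 ?_
    rintro ω ⟨_, h1⟩ ⟨_, h2⟩
    exact htt' (Prod.mk.inj (h1.symm.trans h2)).1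
  · intro v _
    refine MeasurableSet.inter (MeasurableSet.inter ?_ ?_) ?_
    · exact pastSigma_le hW.measurable _ _ hE
    · exact pastSigma_le hW.measurable _ _ (measurableSet_pairStays W B _ n)
    · exact hW.measurable _ (measurableSet_singleton (v, v))

/-- The probability of meeting at two times, the walks being confined to `B₁` until the first
time and to `B₂` until the second. -/
theorem IsWalkPair.measureReal_inter_pairMeets_pairMeets_le (hW : IsWalkPair G μ W)
    {B B₁ B₂ : Finset V} (h₁₂ : ∀ v, v ∈ B₁ → v ∈ B₂ → v ∈ B) (hB : B ⊆ B₂) {n n' : ℕ}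
    (hn : n ≤ n') {m : ℕ} {E : Set Ω} (hE : MeasurableSet[pastSigma W m] E) {x y : V}
    (hs : E ⊆ {ω | W m ω = (x, y)}) (hx : x ∈ B) :
    μ.real (E ∩ (pairMeets W B₁ m n ∩ pairMeets W B₂ m n')) ≤
      ∑ v ∈ B, μ.real E * (killedHeat G B n x v * killedHeat G B n y v) *
        killedMeet G B₂ (n' - n) v v := by
  obtain ⟨l, rfl⟩ := Nat.exists_eq_add_of_le hn
  set F : V → Set Ω := fun v => E ∩ pairStays W B m n ∩ {ω | W (m + n) ω = (v, v)} with hF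
  have hFm : ∀ v, MeasurableSet[pastSigma W (m + n)] (F v) := fun v =>
    ((pastSigma_mono W (by omega) _ hE).inter (measurableSet_pairStays W B m n)).inter
      (measurable_pastSigma W le_rfl (measurableSet_singleton (v, v)))
  have hsub : E ∩ (pairMeets W B₁ m n ∩ pairMeets W B₂ m (n + l)) ⊆
      ⋃ v ∈ B, F v ∩ pairMeets W B₂ (m + n) l := by
    rintro ω ⟨h1, ⟨h2, h3⟩, h4, h5⟩
    -- Up to the earlier time both confinements hold, so the walks stay in `B`; afterwards only `B₂`
    -- matters, and the chain restarts from `(v, v)`.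
    have h6 : ω ∈ E ∩ pairMeets W B m n := ⟨h1, fun i hi hi' =>
      ⟨h₁₂ _ (h2 i hi hi').1 (h4 i hi (by omega)).1,
        h₁₂ _ (h2 i hi hi').2 (h4 i hi (by omega)).2⟩, h3⟩
    rw [inter_pairMeets hs hx] at h6
    simp only [Set.mem_iUnion] at h6 ⊢
    obtain ⟨v, hv, h6⟩ := h6
    refine ⟨v, hv, h6, fun i hi hi' => h4 i (by omega) (by omega), ?_⟩
    rw [add_assoc]
    exact h5
  refine (measureReal_mono hsub (measure_ne_top _ _)).trans ((measureReal_biUnion_finset_le _ _).trans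
    (Finset.sum_le_sum fun v hv => ?_))
  rw [hW.measureReal_inter_pairMeets l (hFm v) Set.inter_subset_right (hB hv),
    hW.measureReal_inter_pairStays B n hE hs, Nat.add_sub_cancel_left]

theorem IsWalkPair.sum_inter_pairMeets_pairMeets_le (hW : IsWalkPair G μ W)
    {B B₁ B₂ : Finset V} (h₁₂ : ∀ v, v ∈ B₁ → v ∈ B₂ → v ∈ B) (hB : B ⊆ B₂) {M : ℝ}
    (hM : ∀ v ∈ B, ∀ L, ∑ l ∈ Finset.range L, killedMeet G B₂ l v v ≤ M)
    {m : ℕ} {E : Set Ω} (hE : MeasurableSet[pastSigma W m] E) {x y : V}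
    (hs : E ⊆ {ω | W m ω = (x, y)}) (hx : x ∈ B) (L : ℕ) :
    ∑ n ∈ Finset.range L, ∑ n' ∈ Finset.range L with n ≤ n',
      μ.real (E ∩ (pairMeets W B₁ m n ∩ pairMeets W B₂ m n')) ≤
        μ.real E * (∑ n ∈ Finset.range L, killedMeet G B n x y) * M := by
  rw [Finset.mul_sum, Finset.sum_mul]
  refine Finset.sum_le_sum fun n _ => ?_
  have hp : ∀ v, 0 ≤ μ.real E * (killedHeat G B n x v * killedHeat G B n y v) := fun v =>
    mul_nonneg measureReal_nonneg (mul_nonneg (killedHeat_nonneg n x v) (killedHeat_nonneg n y v))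
  calc _ ≤ ∑ n' ∈ Finset.range L with n ≤ n', ∑ v ∈ B,
        μ.real E * (killedHeat G B n x v * killedHeat G B n y v) *
          killedMeet G B₂ (n' - n) v v :=
        Finset.sum_le_sum fun n' hn' => hW.measureReal_inter_pairMeets_pairMeets_le h₁₂ hB
          (Finset.mem_filter.1 hn').2 hE hs hx
    _ = ∑ v ∈ B, μ.real E * (killedHeat G B n x v * killedHeat G B n y v) *
          ∑ n' ∈ Finset.range L with n ≤ n', killedMeet G B₂ (n' - n) v v := by
        rw [Finset.sum_comm]
        simp only [Finset.mul_sum]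
    _ ≤ ∑ v ∈ B, μ.real E * (killedHeat G B n x v * killedHeat G B n y v) * M := by
        refine Finset.sum_le_sum fun v hv => mul_le_mul_of_nonneg_left ?_ (hp v)
        have himg : ∑ n' ∈ Finset.range L with n ≤ n', killedMeet G B₂ (n' - n) v v =
            ∑ l ∈ ((Finset.range L).filter (n ≤ ·)).image (· - n), killedMeet G B₂ l v v := by
          rw [Finset.sum_image]
          intro a ha b hb hab
          have ha := (Finset.mem_filter.1 ha).2
          have hb := (Finset.mem_filter.1 hb).2
          simp only at hab ha hb
          omega
        rw [himg]
        refine (Finset.sum_le_sum_of_subset_of_nonneg ?_ fun l _ _ =>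
          killedMeet_nonneg l v v).trans (hM v hv L)
        intro l hl
        simp only [Finset.mem_image, Finset.mem_filter, Finset.mem_range] at hl ⊢
        omega
    _ = _ := by rw [killedMeet, Finset.mul_sum, Finset.sum_mul]

end WalkPair

/-- The second moment method for a weighted sum of indicators. -/
theorem second_moment_bound {Ω ι : Type*} [MeasurableSpace Ω] (μ : Measure Ω) [IsFiniteMeasure μ]
    (I : Finset ι) (a : ι → ℝ) {A : ι → Set Ω} (hA : ∀ q ∈ I, MeasurableSet (A q)) (t : ℝ) :
    2 * t * ∑ q ∈ I, a q * μ.real (A q) -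
      t ^ 2 * ∑ q ∈ I, ∑ r ∈ I, a q * a r * μ.real (A q ∩ A r) ≤ μ.real (⋃ q ∈ I, A q) := by
  set Z : Ω → ℝ := fun ω => ∑ q ∈ I, a q * (A q).indicator 1 ω with hZ
  have hone : ∀ S : Set Ω, MeasurableSet S → Integrable (S.indicator (1 : Ω → ℝ)) μ := fun S hS =>
    (integrable_const (1 : ℝ)).indicator hS
  have hU : MeasurableSet (⋃ q ∈ I, A q) := Finset.measurableSet_biUnion I hA
  have hZ2 : ∀ ω, Z ω ^ 2 = ∑ q ∈ I, ∑ r ∈ I, a q * a r * (A q ∩ A r).indicator 1 ω := by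
    intro ω
    rw [sq, hZ, Finset.sum_mul_sum]
    refine Finset.sum_congr rfl fun q _ => Finset.sum_congr rfl fun r _ => ?_
    rw [Set.inter_indicator_one, Pi.mul_apply]
    ring
  have hI1 : Integrable Z μ := integrable_finsetSum _ fun q hq => (hone _ (hA q hq)).const_mul _
  have hI2 : Integrable (fun ω => Z ω ^ 2) μ := by
    simp only [hZ2]
    exact integrable_finsetSum _ fun q hq => integrable_finsetSum _ fun r hr =>
      (hone _ ((hA q hq).inter (hA r hr))).const_mul _
  have e1 : ∫ ω, Z ω ∂μ = ∑ q ∈ I, a q * μ.real (A q) := by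
    rw [integral_finsetSum _ fun q hq => (hone _ (hA q hq)).const_mul _]
    refine Finset.sum_congr rfl fun q hq => ?_
    rw [integral_const_mul, integral_indicator_one (hA q hq)]
  have e2 : ∫ ω, Z ω ^ 2 ∂μ = ∑ q ∈ I, ∑ r ∈ I, a q * a r * μ.real (A q ∩ A r) := by
    simp only [hZ2]
    rw [integral_finsetSum _ fun q hq => integrable_finsetSum _ fun r hr =>
      (hone _ ((hA q hq).inter (hA r hr))).const_mul _]
    refine Finset.sum_congr rfl fun q hq => ?_
    rw [integral_finsetSum _ fun r hr => (hone _ ((hA q hq).inter (hA r hr))).const_mul _]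
    refine Finset.sum_congr rfl fun r hr => ?_
    rw [integral_const_mul, integral_indicator_one ((hA q hq).inter (hA r hr))]
  rw [← e1, ← e2, ← integral_const_mul, ← integral_const_mul,
    ← integral_sub (hI1.const_mul _) (hI2.const_mul _), ← integral_indicator_one hU]
  refine integral_mono ((hI1.const_mul _).sub (hI2.const_mul _)) (hone _ hU) fun ω => ?_
  by_cases hω : ω ∈ ⋃ q ∈ I, A q
  · simp only [Set.indicator_of_mem hω, Pi.one_apply]
    -- The whole method is `2 * t * Z - t ^ 2 * Z ^ 2 ≤ 1`, with left side 0 where `Z = 0`.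
    nlinarith [sq_nonneg (1 - t * Z ω)]
  · have : Z ω = 0 := by
      refine Finset.sum_eq_zero fun q hq => ?_
      have : ω ∉ A q := fun h => hω (Set.mem_biUnion hq h)
      rw [Set.indicator_of_notMem this, mul_zero]
    simp [this, Set.indicator_of_notMem hω]

/-! ### Sums over dyadic scales -/

section DyadicSums

theorem sum_geometric_le_two (I : Finset ℕ) (k : ℕ) :
    ∑ j ∈ I with j ≤ k, (1 / 2 : ℝ) ^ (k - j) ≤ 2 := by
  have himg : ∑ j ∈ I with j ≤ k, (1 / 2 : ℝ) ^ (k - j) =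
      ∑ l ∈ (I.filter (· ≤ k)).image (k - ·), (1 / 2 : ℝ) ^ l := by
    rw [Finset.sum_image]
    intro a ha b hb hab
    have ha := (Finset.mem_filter.1 ha).2
    have hb := (Finset.mem_filter.1 hb).2
    simp only at hab ha hb
    omega
  rw [himg]
  refine (Finset.sum_le_sum_of_subset_of_nonneg (t := Finset.range (k + 1)) ?_
    fun l _ _ => by positivity).trans (sum_geometric_two_le (k + 1))
  intro l hl
  simp only [Finset.mem_image, Finset.mem_filter, Finset.mem_range] at hl ⊢
  omega

/-- The second moment of the weighted number of meetings, scale by scale. -/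
theorem sum_dyadic_second_moment_le {I : Finset ℕ} (hI : ∀ k ∈ I, 1 ≤ k) {A : ℝ} (hA : 0 ≤ A) :
    ∑ j ∈ I, ∑ k ∈ I, (1 / (j * 2 ^ j) : ℝ) * (1 / (k * 2 ^ k)) *
      (2 ^ min j k * (2 ^ k + A * (min j k * 2 ^ min j k))) ≤
      (∑ k ∈ I, 1 / (k : ℝ)) ^ 2 + A * (4 * ∑ k ∈ I, 1 / (k : ℝ)) := by
  have hpt : ∀ j ∈ I, ∀ k ∈ I, (1 / (j * 2 ^ j) : ℝ) * (1 / (k * 2 ^ k)) *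
      (2 ^ min j k * (2 ^ k + A * (min j k * 2 ^ min j k))) ≤
      1 / (j : ℝ) * (1 / k) + A * ((if j ≤ k then 1 / (k : ℝ) * (1 / 2) ^ (k - j) else 0) +
        if k ≤ j then 1 / (j : ℝ) * (1 / 2) ^ (j - k) else 0) := by
    intro j hj k hk
    have hj1 : (0 : ℝ) < j := by exact_mod_cast hI j hj
    have hk1 : (0 : ℝ) < k := by exact_mod_cast hI k hk
    have h1 : (1 / (j * 2 ^ j) : ℝ) * (1 / (k * 2 ^ k)) * (2 ^ min j k * 2 ^ k) ≤
        1 / (j : ℝ) * (1 / k) := by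
      calc (1 / (j * 2 ^ j) : ℝ) * (1 / (k * 2 ^ k)) * (2 ^ min j k * 2 ^ k)
          ≤ (1 / (j * 2 ^ j) : ℝ) * (1 / (k * 2 ^ k)) * (2 ^ j * 2 ^ k) := by
            gcongr
            · norm_num
            · exact min_le_left j k
        _ = _ := by field_simp
    have h2 : (1 / (j * 2 ^ j) : ℝ) * (1 / (k * 2 ^ k)) *
        (2 ^ min j k * (((min j k : ℕ) : ℝ) * 2 ^ min j k)) ≤
        (if j ≤ k then 1 / (k : ℝ) * (1 / 2) ^ (k - j) else 0) +
        if k ≤ j then 1 / (j : ℝ) * (1 / 2) ^ (j - k) else 0 := by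
      rcases le_total j k with h | h
      · have : (0 : ℝ) ≤ if k ≤ j then 1 / (j : ℝ) * (1 / 2) ^ (j - k) else 0 := by
          split_ifs <;> positivity
        rw [if_pos h, min_eq_left h]
        refine le_add_of_le_of_nonneg (le_of_eq ?_) this
        obtain ⟨d, rfl⟩ := Nat.exists_eq_add_of_le h
        rw [Nat.add_sub_cancel_left, pow_add, one_div_pow]
        field_simp
      · have : (0 : ℝ) ≤ if j ≤ k then 1 / (k : ℝ) * (1 / 2) ^ (k - j) else 0 := by
          split_ifs <;> positivity
        rw [if_pos h, min_eq_right h]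
        refine le_add_of_nonneg_of_le this (le_of_eq ?_)
        obtain ⟨d, rfl⟩ := Nat.exists_eq_add_of_le h
        rw [Nat.add_sub_cancel_left, pow_add, one_div_pow]
        field_simp
    have h3 := mul_le_mul_of_nonneg_left h2 hA
    push_cast at h3 ⊢
    linarith
  have hs : ∑ j ∈ I, ∑ k ∈ I, (if j ≤ k then 1 / (k : ℝ) * (1 / 2) ^ (k - j) else 0) ≤
      2 * ∑ k ∈ I, 1 / (k : ℝ) := by
    rw [Finset.sum_comm, Finset.mul_sum]
    refine Finset.sum_le_sum fun k _ => ?_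
    rw [← Finset.sum_filter, ← Finset.mul_sum, mul_comm]
    exact mul_le_mul_of_nonneg_right (sum_geometric_le_two I k) (by positivity)
  have hs' : ∑ j ∈ I, ∑ k ∈ I, (if k ≤ j then 1 / (j : ℝ) * (1 / 2) ^ (j - k) else 0) ≤
      2 * ∑ k ∈ I, 1 / (k : ℝ) := by
    rw [Finset.sum_comm]; exact hs
  refine (Finset.sum_le_sum fun j hj => Finset.sum_le_sum fun k hk => hpt j hj k hk).trans ?_
  simp only [Finset.sum_add_distrib, ← Finset.mul_sum]
  rw [sq, ← Finset.sum_mul]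
  gcongr
  linarith

theorem half_le_sum_inv {k : ℕ} (hk : 1 ≤ k) :
    (1 / 2 : ℝ) ≤ ∑ i ∈ Finset.Icc k (2 * k), 1 / (i : ℝ) := by
  have hk0 : (0 : ℝ) < k := by exact_mod_cast hk
  have h := Finset.card_nsmul_le_sum (Finset.Icc k (2 * k)) (fun i => 1 / (i : ℝ))
    (1 / (2 * k)) fun i hi => by
      obtain ⟨h1, h2⟩ := Finset.mem_Icc.1 hi
      have h3 : (0 : ℝ) < i := by exact_mod_cast hk.trans h1
      have h4 : (i : ℝ) ≤ 2 * k := by exact_mod_cast h2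
      exact one_div_le_one_div_of_le h3 h4
  refine le_trans ?_ h
  rw [Nat.card_Icc, nsmul_eq_mul, show 2 * k + 1 - k = k + 1 by omega]
  push_cast
  rw [mul_one_div, le_div_iff₀ (by positivity)]
  linarith

/-- A double sum of symmetric nonnegative terms is at most twice its part over ordered times. -/
theorem sum_sum_le_two_mul_ordered (I : Finset ℕ) (L : ℕ) (F : ℕ → ℕ → ℕ → ℕ → ℝ)
    (h0 : ∀ j n k n', 0 ≤ F j n k n') (hF : ∀ j n k n', F j n k n' = F k n' j n) :
    ∑ q ∈ I ×ˢ Finset.range L, ∑ r ∈ I ×ˢ Finset.range L, F q.1 q.2 r.1 r.2 ≤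
      2 * ∑ j ∈ I, ∑ k ∈ I, ∑ n ∈ Finset.range L, ∑ n' ∈ Finset.range L with n ≤ n',
        F j n k n' := by
  have e1 : ∑ j ∈ I, ∑ k ∈ I, ∑ n ∈ Finset.range L, ∑ n' ∈ Finset.range L with n ≤ n',
      F j n k n' = ∑ q ∈ I ×ˢ Finset.range L, ∑ r ∈ I ×ˢ Finset.range L,
        if q.2 ≤ r.2 then F q.1 q.2 r.1 r.2 else 0 := by
    rw [Finset.sum_product]
    refine Finset.sum_congr rfl fun j _ => ?_
    rw [Finset.sum_comm]
    refine Finset.sum_congr rfl fun n _ => ?_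
    rw [Finset.sum_product]
    simp only [Finset.sum_filter]
  have e2 : ∑ q ∈ I ×ˢ Finset.range L, ∑ r ∈ I ×ˢ Finset.range L,
      (if r.2 ≤ q.2 then F q.1 q.2 r.1 r.2 else 0) = ∑ q ∈ I ×ˢ Finset.range L,
      ∑ r ∈ I ×ˢ Finset.range L, if q.2 ≤ r.2 then F q.1 q.2 r.1 r.2 else 0 := by
    rw [Finset.sum_comm]
    refine Finset.sum_congr rfl fun q _ => Finset.sum_congr rfl fun r _ => ?_
    rw [hF]
  rw [e1, two_mul]
  nth_rewrite 2 [← e2]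
  simp only [← Finset.sum_add_distrib]
  refine Finset.sum_le_sum fun q _ => Finset.sum_le_sum fun r _ => ?_
  have := h0 q.1 q.2 r.1 r.2
  rcases le_total q.2 r.2 with h | h
  · rw [if_pos h]; split_ifs <;> linarith
  · rw [if_pos h]; split_ifs <;> linarith

end DyadicSums

/-! ### Uniform lower bound for the meeting probability -/

section Meetings

variable {f : ℤ → ℝ} {Ω : Type*} [MeasurableSpace Ω] {μ : Measure Ω} [IsFiniteMeasure μ]
  {W : ℕ → Ω → combVertices f × combVertices f}

theorem sum_killedMeet_combBox_le (hf : ∀ x, 0 ≤ f x) {R : ℕ} {x y : combVertices f}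
    (hx : x ∈ combBox f R) (hy : y ∈ combBox f R) {H : ℝ} (hH : |(x.1.2 : ℝ)| ≤ H) (L : ℕ) :
    ∑ n ∈ Finset.range L, killedMeet (wedgeComb f) (combBox f R) n x y ≤ 16 * (R + H) := by
  have h1 := sum_killedMeet_le (degree_wedgeComb hf) hx hy (hasSum_killedHeat_combBox hf hx hy) L
  have hd : ((wedgeComb f).degree y : ℝ) ≤ 4 := by exact_mod_cast (degree_wedgeComb hf y).2
  have hv := combVoltage_le (mem_combBox.1 hx) (mem_combBox.1 hy)
  have hv0 := combVoltage_nonneg (mem_combBox.1 hx) (mem_combBox.1 hy)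
  refine h1.trans ?_
  have h2 := mul_le_mul hd hv hv0 (by norm_num)
  push_cast
  linarith

theorem eventually_le_sum_killedMeet_combBox (hf : ∀ x, 0 ≤ f x) {R : ℕ} (hR : 0 < R)
    {x y : combVertices f} (hx : 2 * |x.1.1| ≤ R) (hy : 2 * |y.1.1| ≤ R)
    (hxy : combParity x = combParity y) :
    ∀ᶠ L in atTop, (R : ℝ) / 64 ≤
      ∑ n ∈ Finset.range L, killedMeet (wedgeComb f) (combBox f R) n x y := by
  have hxB : x ∈ combBox f R := by rw [mem_combBox]; omega
  have hyB : y ∈ combBox f R := by rw [mem_combBox]; omega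
  have hd : (1 : ℝ) ≤ (wedgeComb f).degree y := by exact_mod_cast (degree_wedgeComb hf y).1
  have hv := le_combVoltage hR hx hy
  have hR' : (0 : ℝ) < R := by exact_mod_cast hR
  have hb : (R : ℝ) / 16 < (wedgeComb f).degree y * combVoltage R y.1 x.1 := by nlinarith
  filter_upwards [eventually_le_sum_killedMeet (degree_wedgeComb hf) combParity_adj hxB hyB hxy
    (hasSum_killedHeat_combBox hf hxB hyB) hb] with L hL
  push_cast at hL
  linarith

/-- From any two vertices of the same colour, the walkers meet with a probability that is bounded
below. -/
theorem exists_meeting_probability (hf : ∀ x, 0 ≤ f x) {A : ℝ} (hA : 0 ≤ A)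
    (hfA : ∀ i : ℕ, 1 ≤ i → ∀ x : ℤ, |x| < (2 ^ i : ℕ) → f x ≤ A * (i * 2 ^ i))
    (hW : IsWalkPair (wedgeComb f) μ W) {m : ℕ} {E : Set Ω} (hE : MeasurableSet[pastSigma W m] E)
    {x y : combVertices f} (hs : E ⊆ {ω | W m ω = (x, y)}) (hxy : combParity x = combParity y) :
    1 / (4096 * (1024 * (1 + 8 * A))) * μ.real E ≤
      μ.real (E ∩ {ω | ∃ n, m ≤ n ∧ (W n ω).1 = (W n ω).2}) := by
  -- Every box from scale `N` on contains both starting points in its middle half and is wider than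
  -- the height of `x`. The final constant does not see `N`.
  set N := 2 * x.1.1.natAbs + 2 * y.1.1.natAbs + x.1.2.natAbs + 1 with hN
  have hNpow : ∀ k, N ≤ k → N < 2 ^ k := fun k hk => hk.trans_lt Nat.lt_two_pow_self
  set I := Finset.Icc N (2 * N) with hI
  have hI1 : ∀ k ∈ I, 1 ≤ k := fun k hk => by
    have := (Finset.mem_Icc.1 hk).1; omega
  have hIN : ∀ k ∈ I, N < 2 ^ k := fun k hk => hNpow k (Finset.mem_Icc.1 hk).1
  set S : ℝ := ∑ k ∈ I, 1 / (k : ℝ) with hS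
  have hS2 : 1 / 2 ≤ S := half_le_sum_inv (by omega)
  set B : ℕ → Finset (combVertices f) := fun k => combBox f (2 ^ k) with hB
  have hx2 : ∀ k ∈ I, 2 * |x.1.1| ≤ (2 ^ k : ℕ) := fun k hk => by
    have h1 : ((N : ℕ) : ℤ) < ((2 ^ k : ℕ) : ℤ) := by exact_mod_cast hIN k hk
    rw [Int.abs_eq_natAbs]; omega
  have hy2 : ∀ k ∈ I, 2 * |y.1.1| ≤ (2 ^ k : ℕ) := fun k hk => by
    have h1 : ((N : ℕ) : ℤ) < ((2 ^ k : ℕ) : ℤ) := by exact_mod_cast hIN k hk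
    rw [Int.abs_eq_natAbs]; omega
  have hpos : ∀ k : ℕ, (0 : ℤ) < ((2 ^ k : ℕ) : ℤ) := fun k => by positivity
  have hxB : ∀ k ∈ I, x ∈ B k := fun k hk => by
    have := hx2 k hk; have := hpos k; rw [mem_combBox]; omega
  have hyB : ∀ k ∈ I, y ∈ B k := fun k hk => by
    have := hy2 k hk; have := hpos k; rw [mem_combBox]; omega
  have hxH : ∀ k ∈ I, |(x.1.2 : ℝ)| ≤ 2 ^ k := fun k hk => by
    have h1 : x.1.2.natAbs ≤ 2 ^ k := by have := hIN k hk; omega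
    have h2 : |x.1.2| ≤ ((2 ^ k : ℕ) : ℤ) := by rw [Int.abs_eq_natAbs]; exact_mod_cast h1
    exact_mod_cast h2
  obtain ⟨L, hL⟩ : ∃ L, ∀ k ∈ I, ((2 ^ k : ℕ) : ℝ) / 64 ≤
      ∑ n ∈ Finset.range L, killedMeet (wedgeComb f) (B k) n x y := by
    have : ∀ᶠ L in atTop, ∀ k ∈ I, ((2 ^ k : ℕ) : ℝ) / 64 ≤
        ∑ n ∈ Finset.range L, killedMeet (wedgeComb f) (B k) n x y :=
      (Filter.eventually_all_finset I).2 fun k hk =>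
        eventually_le_sum_killedMeet_combBox hf (by positivity) (hx2 k hk) (hy2 k hk) hxy
    exact this.exists
  set a : ℕ → ℝ := fun k => 1 / (k * 2 ^ k) with ha
  have ha0 : ∀ k, 0 ≤ a k := fun k => by positivity
  set P : ℕ → ℕ → Set Ω := fun k n => E ∩ pairMeets W (B k) m n with hP
  have hPm : ∀ k n, MeasurableSet (P k n) := fun k n =>
    (pastSigma_le hW.measurable _ _ hE).inter
      (pastSigma_le hW.measurable _ _ (measurableSet_pairMeets W (B k) m n))
  set π := μ.real E with hπ
  have hπ0 : 0 ≤ π := measureReal_nonneg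
  have first : π * S / 64 ≤
      ∑ q ∈ I ×ˢ Finset.range L, a q.1 * μ.real (P q.1 q.2) := by
    rw [Finset.sum_product, hS, Finset.mul_sum, Finset.sum_div]
    refine Finset.sum_le_sum fun k hk => ?_
    simp only [← Finset.mul_sum]
    have e : ∑ n ∈ Finset.range L, μ.real (P k n) =
        π * ∑ n ∈ Finset.range L, killedMeet (wedgeComb f) (B k) n x y := by
      rw [Finset.mul_sum]
      exact Finset.sum_congr rfl fun n _ =>
        hW.measureReal_inter_pairMeets n hE hs (hxB k hk)
    rw [e]
    have hk0 : (0 : ℝ) < k := by exact_mod_cast hI1 k hk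
    calc π * (1 / k) / 64 = a k * (π * (((2 ^ k : ℕ) : ℝ) / 64)) := by
          simp only [ha]; push_cast; field_simp
      _ ≤ _ := mul_le_mul_of_nonneg_left (mul_le_mul_of_nonneg_left (hL k hk) hπ0) (ha0 k)
  have second : ∑ q ∈ I ×ˢ Finset.range L, ∑ r ∈ I ×ˢ Finset.range L,
      a q.1 * a r.1 * μ.real (P q.1 q.2 ∩ P r.1 r.2) ≤
        1024 * π * (S ^ 2 + A * (4 * S)) := by
    refine (sum_sum_le_two_mul_ordered I L
      (fun j n k n' => a j * a k * μ.real (P j n ∩ P k n'))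
      (fun j n k n' => mul_nonneg (mul_nonneg (ha0 j) (ha0 k)) measureReal_nonneg)
      (fun j n k n' => by rw [Set.inter_comm, mul_comm (a j)])).trans ?_
    -- The first meeting costs `16 * (2 * 2 ^ min j k)`, the return after it `16 * (2 ^ k +
    -- height)`, whence 512; the height is controlled in the smaller box, where the first meeting
    -- occurs.
    have hjk : ∀ j ∈ I, ∀ k ∈ I, ∑ n ∈ Finset.range L, ∑ n' ∈ Finset.range L with n ≤ n',
        a j * a k * μ.real (P j n ∩ P k n') ≤ 512 * π * (a j * a k *
          (2 ^ min j k * (2 ^ k + A * (min j k * 2 ^ min j k)))) := by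
      intro j hj k hk
      have hi : min j k ∈ I := by rcases min_choice j k with h | h <;> rw [h] <;> assumption
      have h₁₂ : ∀ v, v ∈ B j → v ∈ B k → v ∈ B (min j k) := fun v h1 h2 => by
        rcases min_choice j k with h | h <;> rw [h] <;> assumption
      have hBk : B (min j k) ⊆ B k :=
        combBox_mono f (Nat.pow_le_pow_right (by norm_num) (min_le_right j k))
      have hM : ∀ v ∈ B (min j k), ∀ L', ∑ l ∈ Finset.range L',
          killedMeet (wedgeComb f) (B k) l v v ≤
            16 * (((2 ^ k : ℕ) : ℝ) + A * (((min j k : ℕ) : ℝ) * 2 ^ min j k)) :=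
        fun v hv L' => sum_killedMeet_combBox_le hf (hBk hv) (hBk hv)
          ((abs_le.2 v.2).trans (hfA _ (hI1 _ hi) _ (mem_combBox.1 hv))) L'
      have h1 := hW.sum_inter_pairMeets_pairMeets_le h₁₂ hBk hM hE hs (hxB _ hi) L
      have h2 := sum_killedMeet_combBox_le hf (hxB _ hi) (hyB _ hi) (hxH _ hi) L
      simp only [← Finset.mul_sum]
      have e : ∀ n n', P j n ∩ P k n' = E ∩ (pairMeets W (B j) m n ∩ pairMeets W (B k) m n') :=
        fun n n' => (Set.inter_inter_distrib_left _ _ _).symm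
      simp only [e]
      have h3 : π * (∑ n ∈ Finset.range L, killedMeet (wedgeComb f) (B (min j k)) n x y) *
          (16 * (((2 ^ k : ℕ) : ℝ) + A * (((min j k : ℕ) : ℝ) * 2 ^ min j k))) ≤
          π * (16 * (((2 ^ min j k : ℕ) : ℝ) + 2 ^ min j k)) *
          (16 * (((2 ^ k : ℕ) : ℝ) + A * (((min j k : ℕ) : ℝ) * 2 ^ min j k))) :=
        mul_le_mul_of_nonneg_right (mul_le_mul_of_nonneg_left h2 hπ0) (by positivity)
      refine (mul_le_mul_of_nonneg_left (h1.trans h3) (mul_nonneg (ha0 j) (ha0 k))).trans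
        (le_of_eq ?_)
      push_cast
      ring
    have h4 : ∑ j ∈ I, ∑ k ∈ I, ∑ n ∈ Finset.range L, ∑ n' ∈ Finset.range L with n ≤ n',
        a j * a k * μ.real (P j n ∩ P k n') ≤ 512 * π * (S ^ 2 + A * (4 * S)) := by
      refine (Finset.sum_le_sum fun j hj => Finset.sum_le_sum fun k hk => hjk j hj k hk).trans ?_
      simp only [← Finset.mul_sum]
      exact mul_le_mul_of_nonneg_left (sum_dyadic_second_moment_le hI1 hA) (by positivity)
    linarith
  set C : ℝ := 1024 * (1 + 8 * A) with hC
  have hC0 : 0 < C := by positivity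
  have second' : 1024 * π * (S ^ 2 + A * (4 * S)) ≤ C * π * S ^ 2 := by
    have : A * (4 * S) ≤ 8 * A * S ^ 2 := by nlinarith [mul_nonneg hA (by linarith : 0 ≤ S)]
    calc 1024 * π * (S ^ 2 + A * (4 * S)) ≤ 1024 * π * (S ^ 2 + 8 * A * S ^ 2) := by gcongr
      _ = _ := by rw [hC]; ring
  have hS0 : 0 < S := by linarith
  -- This `t` maximises `2 * t * (π * S / 64) - t ^ 2 * (C * π * S ^ 2)`.
  have main := second_moment_bound μ (I ×ˢ Finset.range L) (fun q => a q.1)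
    (A := fun q => P q.1 q.2) (fun q _ => hPm q.1 q.2) (1 / (64 * C * S))
  have hsub : (⋃ q ∈ I ×ˢ Finset.range L, P q.1 q.2) ⊆
      E ∩ {ω | ∃ n, m ≤ n ∧ (W n ω).1 = (W n ω).2} := by
    intro ω hω
    simp only [Set.mem_iUnion] at hω
    obtain ⟨q, _, h1, _, h2⟩ := hω
    exact ⟨h1, m + q.2, by omega, h2⟩
  refine le_trans ?_ (main.trans (measureReal_mono hsub))
  have ht : 0 ≤ 1 / (64 * C * S) := by positivity
  calc 1 / (4096 * C) * π = 2 * (1 / (64 * C * S)) * (π * S / 64) -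
        (1 / (64 * C * S)) ^ 2 * (C * π * S ^ 2) := by field_simp; ring
    _ ≤ _ := sub_le_sub (mul_le_mul_of_nonneg_left first (by positivity))
        (mul_le_mul_of_nonneg_left (second.trans second') (by positivity))

end Meetings

/-! ### From a uniform meeting probability to infinitely many meetings -/

theorem measure_eq_tsum_inter_preimage {Ω S : Type*} [MeasurableSpace Ω] {μ : Measure Ω}
    [MeasurableSpace S] [Countable S]
    [MeasurableSingletonClass S] {X : Ω → S} (hX : Measurable X) {F : Set Ω}
    (hF : MeasurableSet F) : μ F = ∑' s, μ (F ∩ {ω | X ω = s}) := by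
  rw [← measure_iUnion]
  · congr 1
    ext ω
    simp
  · intro s t hst
    refine Set.disjoint_left.2 ?_
    rintro ω ⟨_, h1⟩ ⟨_, h2⟩
    exact hst (h1.symm.trans h2)
  · exact fun s => hF.inter (hX (measurableSet_singleton s))

section Infinite

variable {V : Type*} [MeasurableSpace V] [Countable V] [MeasurableSingletonClass V]
  {Ω : Type*} [MeasurableSpace Ω] {G : SimpleGraph V} [G.LocallyFinite] {μ : Measure Ω}
  [IsFiniteMeasure μ] {W : ℕ → Ω → V × V}

/-- Both walkers change colour at every step, so the agreement at time 0 persists. -/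
theorem IsWalkPair.measure_parity_ne (hW : IsWalkPair G μ W) {c : V → ZMod 2}
    (hc : ∀ v w, G.Adj v w → c w = c v + 1) {o : V} (h0 : ∀ᵐ ω ∂μ, W 0 ω = (o, o)) (n : ℕ)
    (s : V × V) (hs : c s.1 ≠ c s.2) : μ {ω | W n ω = s} = 0 := by
  induction n generalizing s with
  | zero =>
    refine measure_mono_null ?_ h0
    intro ω (hω : W 0 ω = s) (h : W 0 ω = (o, o))
    rw [← hω, h] at hs
    exact hs rfl
  | succ n ih =>
    have hsub : {ω | W (n + 1) ω = s} ⊆ ⋃ r, {ω | W n ω = r} ∩ {ω | W (n + 1) ω = s} :=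
      fun ω hω => Set.mem_iUnion.2 ⟨W n ω, rfl, hω⟩
    refine measure_mono_null hsub (measure_iUnion_null fun r => ?_)
    by_cases hr : c r.1 = c r.2
    · have hE : MeasurableSet[pastSigma W n] {ω | W n ω = r} :=
        measurable_pastSigma W le_rfl (measurableSet_singleton r)
      rw [← measureReal_eq_zero_iff, hW.measureReal_inter_step hE subset_rfl]
      have : ¬ (G.Adj r.1 s.1 ∧ G.Adj r.2 s.2) := fun h => hs <| by
        rw [hc _ _ h.1, hc _ _ h.2, hr]
      rcases not_and_or.1 this with h | h <;> simp [srwStep, h]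
    · exact measure_mono_null Set.inter_subset_left (ih r hr)

/-- If the conditional probability of a future meeting given the past is always bounded below, then
there are infinitely many meetings. -/
theorem IsWalkPair.ae_infinite_meetings (hW : IsWalkPair G μ W) {c : ℝ} (hc : 0 < c)
    (h : ∀ (m : ℕ) (E : Set Ω) (s : V × V), MeasurableSet[pastSigma W m] E →
      E ⊆ {ω | W m ω = s} → c * μ.real E ≤
        μ.real (E ∩ {ω | ∃ n, m ≤ n ∧ (W n ω).1 = (W n ω).2})) :
    ∀ᵐ ω ∂μ, {n : ℕ | (W n ω).1 = (W n ω).2}.Infinite := by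
  have hdiag : ∀ n, MeasurableSet[pastSigma W n] {ω | (W n ω).1 = (W n ω).2} := fun n =>
    measurable_pastSigma W le_rfl (MeasurableSet.of_discrete (s := {p : V × V | p.1 = p.2}))
  set H : ℕ → Set Ω := fun m => {ω | ∃ n, m ≤ n ∧ (W n ω).1 = (W n ω).2} with hH
  have hHm : ∀ m, MeasurableSet (H m) := fun m => by
    simp only [hH, Set.ofPred_exists]
    exact MeasurableSet.iUnion fun n => (MeasurableSet.const _).inter
      (pastSigma_le hW.measurable n _ (hdiag n))
  have step : ∀ (m : ℕ) (F : Set Ω), MeasurableSet[pastSigma W m] F →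
      c * μ.real F ≤ μ.real (F ∩ H m) := by
    intro m F hF
    have hFm := pastSigma_le hW.measurable m _ hF
    have key : ENNReal.ofReal c * μ F ≤ μ (F ∩ H m) := by
      rw [measure_eq_tsum_inter_preimage (hW.measurable m) hFm,
        measure_eq_tsum_inter_preimage (hW.measurable m) (hFm.inter (hHm m)),
        ← ENNReal.tsum_mul_left]
      refine ENNReal.tsum_le_tsum fun s => ?_
      have h1 := h m (F ∩ {ω | W m ω = s}) s
        (hF.inter (measurable_pastSigma W le_rfl (measurableSet_singleton s)))
        Set.inter_subset_right
      rw [Set.inter_right_comm, ← ENNReal.ofReal_toReal (measure_ne_top μ (F ∩ {ω | W m ω = s})),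
        ← ENNReal.ofReal_mul hc.le,
        ← ENNReal.ofReal_toReal (measure_ne_top μ (F ∩ {ω | W m ω = s} ∩ H m))]
      exact ENNReal.ofReal_le_ofReal h1
    have := ENNReal.toReal_mono (measure_ne_top μ _) key
    rwa [ENNReal.toReal_mul, ENNReal.toReal_ofReal hc.le] at this
  have null : ∀ m, μ (H m)ᶜ = 0 := by
    intro m
    set D : ℕ → Set Ω := fun l => {ω | ∀ n, m ≤ n → n ≤ m + l → (W n ω).1 ≠ (W n ω).2} with hD
    have hDm : ∀ l, MeasurableSet[pastSigma W (m + l)] (D l) := fun l => by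
      simp only [hD, Set.ofPred_forall]
      exact MeasurableSet.iInter fun n => MeasurableSet.iInter fun _ => MeasurableSet.iInter
        fun hn => pastSigma_mono W hn _ (hdiag n).compl
    have hDm' : ∀ l, MeasurableSet (D l) := fun l => pastSigma_le hW.measurable _ _ (hDm l)
    have hHD : (H m)ᶜ = ⋂ l, D l := by
      ext ω
      simp only [hH, hD, Set.mem_compl_iff, Set.mem_ofPred_eq, Set.mem_iInter, not_exists, not_and]
      exact ⟨fun h l n hn _ => h n hn, fun h n hn => h n n hn (by omega)⟩
    have hanti : Antitone D := fun l l' hl ω hω n hn hn' => hω n hn (by omega)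
    have hlim : Tendsto (fun l => μ.real (D l)) atTop (nhds (μ.real (H m)ᶜ)) := by
      rw [hHD]
      exact (ENNReal.tendsto_toReal (measure_ne_top _ _)).comp
        (tendsto_measure_iInter_atTop (fun l => (hDm' l).nullMeasurableSet) hanti
          ⟨0, measure_ne_top _ _⟩)
    -- Having no meeting from `m` on is contained in `D l` and excludes any meeting after `m + l`.
    -- As `l → ∞`, `D l` shrinks to this event, whose mass `p` then satisfies `c * p ≤ 0`.
    have hbound : ∀ l, c * μ.real (D l) ≤ μ.real (D l) - μ.real (H m)ᶜ := fun l => by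
      have h1 := step (m + l) (D l) (hDm l)
      have h2 := measureReal_inter_add_sdiff (μ := μ) (s := D l) (hHm (m + l))
      have h3 : μ.real (H m)ᶜ ≤ μ.real (D l \ H (m + l)) := by
        refine measureReal_mono fun ω hω => ⟨?_, ?_⟩
        · rw [hHD] at hω
          exact Set.mem_iInter.1 hω l
        · rintro ⟨n, hn, hn'⟩
          exact hω ⟨n, by omega, hn'⟩
      linarith
    have hle := le_of_tendsto_of_tendsto' (hlim.const_mul c) (hlim.sub_const _) hbound
    rw [sub_self] at hle
    rw [← measureReal_eq_zero_iff]
    exact le_antisymm (nonpos_of_mul_nonpos_right hle hc) measureReal_nonneg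
  have hall : ∀ᵐ ω ∂μ, ∀ m, ω ∈ H m := ae_all_iff.2 fun m => null m
  filter_upwards [hall] with ω hω
  exact Set.infinite_of_forall_exists_gt fun m => by
    obtain ⟨n, hn, hn'⟩ := hω (m + 1)
    exact ⟨n, hn', hn⟩

end Infinite

theorem corollary1p2 (f : ℤ → ℝ) (hf : ∀ x, 0 ≤ f x)
    (hO : (fun n : ℕ => f (-(n : ℤ)) + f (n : ℤ)) =O[atTop]
      fun n : ℕ => (n : ℝ) * Real.log (n : ℝ))
    (o : combVertices f)
    {Ω : Type*} [MeasurableSpace Ω] (μ : Measure Ω) [IsProbabilityMeasure μ]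
    (X X' : ℕ → Ω → combVertices f)
    (hX : IsSimpleRandomWalk (wedgeComb f) o μ X)
    (hX' : IsSimpleRandomWalk (wedgeComb f) o μ X')
    (hXX' : IndepFun (fun ω n => X n ω) (fun ω n => X' n ω) μ) :
    ∀ᵐ ω ∂μ, {n : ℕ | X n ω = X' n ω}.Infinite := by
  obtain ⟨A, hA, hfA⟩ := exists_profile_bound hf hO
  have hW := hX.isWalkPair hX' hXX'
  have h0 : ∀ᵐ ω ∂μ, (X 0 ω, X' 0 ω) = (o, o) := by
    filter_upwards [hX.start, hX'.start] with ω h h'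
    rw [h, h']
  refine hW.ae_infinite_meetings (c := 1 / (4096 * (1024 * (1 + 8 * A)))) (by positivity)
    fun m E s hE hs => ?_
  by_cases hpar : combParity s.1 = combParity s.2
  · exact exists_meeting_probability hf hA hfA hW hE hs hpar
  · have : μ.real E = 0 := by
      rw [measureReal_eq_zero_iff]
      exact measure_mono_null hs (hW.measure_parity_ne combParity_adj h0 m s hpar)
    rw [this, mul_zero]
    exact measureReal_nonneg
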